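/- Let $M$ be a smooth ($C^\infty$, Hausdorff) manifold of dimension $n$ and let $(M,\nabla,h)$ be a generalized pseudo-Hessian structure: $\nabla$ is a smooth torsionless flat connection on $TM$, and $h\in\Gamma(TM\otimes TM)$ is a smooth symmetric bivector field such that, for all smooth one-forms $\alpha,\beta,\gamma$ on $M$, $$(\nabla_{h_\#(\alpha)}h)(\beta,\gamma)=(\nabla_{h_\#(\beta)}h)(\alpha,\gamma),$$ where $h_\#:T^*M\to TM$ is given by $\beta(h_\#(\alpha))=h(\alpha,\beta)$, and $(\nabla_Xh)(\alpha,\beta)=X\cdot h(\alpha,\beta)-h(\nabla^*_X\alpha,\beta)-h(\alpha,\nabla^*_X\beta)$ with $(\nabla^*_X\alpha)(Y)=X\cdot\alpha(Y)-\alpha(\nabla_XY)$. Let $x\in M$ be a point such that the rank of $h_\#$ is constant, equal to $r$, in a neighborhood of $x$. Then there exist a smooth chart $(x_1,\ldots,x_r,y_1,\ldots,y_{n-r})$ of $M$ on an open set $U$ containing $x$, real functions $h_{ij}$ ($1\le i,j\le r$) on $U$ and a smooth function $f=f(x,y)$ of the coordinates, defined on the image of the chart, such that on all of $U$ $$h=\sum_{i,j=1}^r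 h_{ij}\,\partial_{x_i}\otimes\partial_{x_j},\qquad \nabla_{\partial_{x_i}}\partial_{x_j}=0\quad(1\le i,j\le r),$$ and the matrix $(h_{ij})_{1\le i,j\le r}$ is invertible with inverse $$(h_{ij})^{-1}=\left(\frac{\partial^2 f}{\partial x_i\,\partial x_j}\right)_{1\le i,j\le r}.$$ -/

import Mathlib

set_option maxSynthPendingDepth 3

open scoped Manifold ContDiff Topology

namespace GPH

open Bundle

noncomputable section

/-- The model space `ℝⁿ`. -/
abbrev Model (n : ℕ) : Type := EuclideanSpace ℝ (Fin n)

section Fields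

variable (n : ℕ) (M : Type*) [TopologicalSpace M] [ChartedSpace (Model n) M]

/-- The tangent space `T_p M`. -/
abbrev Tan {M : Type*} [TopologicalSpace M] [ChartedSpace (Model n) M] (p : M) : Type :=
  TangentSpace (𝓡 n) p

/-- The cotangent space `T*_p M`. -/
abbrev Cotan {M : Type*} [TopologicalSpace M] [ChartedSpace (Model n) M] (p : M) : Type :=
  Tan n p →L[ℝ] ℝ

/-- Vector fields (with no regularity assumption). -/
abbrev VField : Type _ := (p : M) → Tan n p

/-- One-forms (with no regularity assumption). -/
abbrev OneForm : Type _ := (p : M) → Cotan n p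

/-- Bivector fields, i.e. sections of `TM ⊗ TM` (with no regularity assumption), seen as fields
of bilinear forms on the cotangent spaces. -/
abbrev Bivector : Type _ := (p : M) → Cotan n p →L[ℝ] Cotan n p →L[ℝ] ℝ

/-- Linear connections on `M`. In Mathlib's convention `(∇_X Y)(p)` is `D Y p (X p)`. -/
abbrev Connection [IsManifold (𝓡 n) ∞ M] : Type _ :=
  CovariantDerivative (𝓡 n) (Model n) (TangentSpace (𝓡 n) : M → Type)

end Fields

variable {n : ℕ} {M : Type*} [TopologicalSpace M] [ChartedSpace (Model n) M]

instance (p : M) : FiniteDimensional ℝ (Tan n p) :=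
  inferInstanceAs (FiniteDimensional ℝ (Model n))

instance (p : M) : T2Space (Tan n p) := inferInstanceAs (T2Space (Model n))

/-- The evaluation `α ↦ α u` of covectors at a tangent vector `u`. -/
def evalAt {p : M} (u : Tan n p) : Cotan n p →L[ℝ] ℝ where
  toFun α := α u
  map_add' _ _ := rfl
  map_smul' _ _ := rfl
  cont := continuous_eval_const u

/-- The elementary bivector `u ⊗ v`, as the bilinear form `(α, β) ↦ α u * β v`. -/
def tensor {p : M} (u v : Tan n p) : Cotan n p →L[ℝ] Cotan n p →L[ℝ] ℝ :=
  (evalAt u).smulRight (evalAt v)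

theorem tensor_apply {p : M} (u v : Tan n p) (α β : Cotan n p) :
    tensor u v α β = α u * β v := by
  rfl

/-- The bundle map `h_# : T*M → TM`, characterized by `β (h_# α) = h (α, β)`. -/
def sharp (h : Bivector n M) (p : M) : Cotan n p →ₗ[ℝ] Tan n p :=
  (Module.evalEquiv ℝ (Tan n p)).symm.toLinearMap ∘ₗ
    (LinearMap.toContinuousLinearMap (𝕜 := ℝ) (E := Tan n p) (F' := ℝ)).toLinearMap.dualMap ∘ₗ
    ContinuousLinearMap.coeLM ℝ ∘ₗ (h p).toLinearMap

theorem apply_sharp (h : Bivector n M) (p : M) (α β : Cotan n p) :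
    β (sharp h p α) = h p α β := by
  have := Module.apply_evalEquiv_symm_apply (R := ℝ) (M := Tan n p) β.toLinearMap
    ((LinearMap.toContinuousLinearMap (𝕜 := ℝ) (E := Tan n p) (F' := ℝ)).toLinearMap.dualMap
      (h p α).toLinearMap)
  exact this

/-- The rank of `h_#` at `p`. -/
def rank (h : Bivector n M) (p : M) : ℕ := Module.finrank ℝ (LinearMap.range (sharp h p))

variable [IsManifold (𝓡 n) ∞ M]

/-- `X` is a smooth section of `TM`. -/
def SmoothVField (X : VField n M) : Prop :=
  ContMDiff (𝓡 n) ((𝓡 n).prod 𝓘(ℝ, Model n)) ∞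
    (fun p ↦ TotalSpace.mk' (Model n) (E := fun p : M ↦ Tan n p) p (X p))

/-- `α` is a smooth section of `T*M`. -/
def SmoothOneForm (α : OneForm n M) : Prop :=
  ContMDiff (𝓡 n) ((𝓡 n).prod 𝓘(ℝ, Model n →L[ℝ] ℝ)) ∞
    (fun p ↦ TotalSpace.mk' (Model n →L[ℝ] ℝ) (E := fun p : M ↦ Cotan n p) p (α p))

/-- `h` is a smooth section of `TM ⊗ TM`. -/
def SmoothBivector (h : Bivector n M) : Prop :=
  ContMDiff (𝓡 n) ((𝓡 n).prod 𝓘(ℝ, (Model n →L[ℝ] ℝ) →L[ℝ] (Model n →L[ℝ] ℝ) →L[ℝ] ℝ)) ∞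
    (fun p ↦ TotalSpace.mk' ((Model n →L[ℝ] ℝ) →L[ℝ] (Model n →L[ℝ] ℝ) →L[ℝ] ℝ)
      (E := fun p : M ↦ Cotan n p →L[ℝ] Cotan n p →L[ℝ] ℝ) p (h p))

/-- `Y` is differentiable at `p` as a section of `TM`. -/
def VFieldDiffAt (Y : VField n M) (p : M) : Prop :=
  MDifferentiableAt (𝓡 n) ((𝓡 n).prod 𝓘(ℝ, Model n))
    (fun q ↦ TotalSpace.mk' (Model n) (E := fun q : M ↦ Tan n q) q (Y q)) p

/-- `α` is differentiable at `p` as a section of `T*M`. -/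
def OneFormDiffAt (α : OneForm n M) (p : M) : Prop :=
  MDifferentiableAt (𝓡 n) ((𝓡 n).prod 𝓘(ℝ, Model n →L[ℝ] ℝ))
    (fun q ↦ TotalSpace.mk' (Model n →L[ℝ] ℝ) (E := fun q : M ↦ Cotan n q) q (α q)) p

/-- For a one-form `α` and a vector field `Y`, the covector `v ↦ v.(α(Y)) - α(∇_v Y)` at `p`. -/
def dualDerivAux (D : Connection n M) (α : OneForm n M) (p : M) (Y : VField n M) :
    Tan n p →L[ℝ] ℝ :=
  mvfderiv (𝓡 n) (fun q ↦ α q (Y q)) p - (α p) ∘L (D Y p)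

theorem mdifferentiableAt_pair {α : OneForm n M} {Y : VField n M} {p : M}
    (hα : OneFormDiffAt α p) (hY : VFieldDiffAt Y p) :
    MDifferentiableAt (𝓡 n) 𝓘(ℝ, ℝ) (fun q ↦ α q (Y q)) p := by
  have := MDifferentiableAt.clm_bundle_apply (𝕜 := ℝ) (F₁ := Model n) (F₂ := ℝ)
    (E₁ := fun q : M ↦ Tan n q) (E₂ := Bundle.Trivial M ℝ) (IM := 𝓡 n) (IB := 𝓡 n)
    (b := fun q : M ↦ q) (ϕ := α) (v := Y) (x := p) hα hY
  simp only [mdifferentiableAt_totalSpace] at this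
  exact this.2

theorem dualDerivAux_tensorial (D : Connection n M) {α : OneForm n M} {p : M}
    (hα : OneFormDiffAt α p) :
    TensorialAt (𝓡 n) (Model n) (dualDerivAux D α p) p where
  smul {f Y} hf hY := by
    have h1 : (fun q ↦ α q ((f • Y) q)) = fun q ↦ f q * α q (Y q) := by
      ext q
      simp
    ext v
    simp only [dualDerivAux, h1, mvfderiv_fun_mul hf (mdifferentiableAt_pair hα hY),
      D.isCovariantDerivativeOn.leibniz hY hf]
    simp
    ring
  add {Y Y'} hY hY' := by
    have h1 : (fun q ↦ α q ((Y + Y') q)) = fun q ↦ α q (Y q) + α q (Y' q) := by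
      ext q
      simp
    ext v
    simp only [dualDerivAux, h1,
      mvfderiv_fun_add (mdifferentiableAt_pair hα hY) (mdifferentiableAt_pair hα hY'),
      D.isCovariantDerivativeOn.add hY hY']
    simp
    ring

open Classical in
/-- The dual connection `∇*` on one-forms: `dualDeriv D α p v w` is `(∇*_v α)(w)`, where
`(∇*_X α)(Y) = X.(α(Y)) - α(∇_X Y)`. -/
def dualDeriv (D : Connection n M) (α : OneForm n M) (p : M) (v : Tan n p) : Cotan n p :=
  if hα : OneFormDiffAt α p then
    evalAt v ∘L TensorialAt.mkHom (dualDerivAux D α p) p (dualDerivAux_tensorial D hα)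
  else 0

theorem dualDeriv_apply (D : Connection n M) {α : OneForm n M} {p : M} {Y : VField n M}
    (hα : OneFormDiffAt α p) (hY : VFieldDiffAt Y p) (v : Tan n p) :
    dualDeriv D α p v (Y p) = mvfderiv (𝓡 n) (fun q ↦ α q (Y q)) p v - α p (D Y p v) := by
  have := TensorialAt.mkHom_apply (dualDerivAux_tensorial D hα) hY
  simp only [dualDeriv, hα, dite_true]
  exact congrArg (fun ψ ↦ ψ v) this

/-- The covariant derivative of a bivector field:
`(∇_v h)(α, β) = v.(h(α, β)) - h(∇*_v α, β) - h(α, ∇*_v β)` at `p`. -/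
def covDeriv (D : Connection n M) (h : Bivector n M) (p : M) (v : Tan n p)
    (α β : OneForm n M) : ℝ :=
  mvfderiv (𝓡 n) (fun q ↦ h q (α q) (β q)) p v
    - h p (dualDeriv D α p v) (β p) - h p (α p) (dualDeriv D β p v)

/-- The vector field `∇_X Y`. -/
def nabla (D : Connection n M) (X Y : VField n M) : VField n M := fun p ↦ D Y p (X p)

/-- The curvature `R(X, Y) Z = ∇_X ∇_Y Z - ∇_Y ∇_X Z - ∇_[X, Y] Z` vanishes identically. -/
def IsFlat (D : Connection n M) : Prop :=
  ∀ X Y Z : VField n M, SmoothVField X → SmoothVField Y → SmoothVField Z →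
    nabla D X (nabla D Y Z) - nabla D Y (nabla D X Z)
      - nabla D (VectorField.mlieBracket (𝓡 n) X Y) Z = 0

/-- `(M, ∇, h)` is a generalized pseudo-Hessian manifold: `∇` is a smooth torsionless flat
connection, `h` is a smooth symmetric bivector field, and
`(∇_{h_# α} h)(β, γ) = (∇_{h_# β} h)(α, γ)` for all smooth one-forms `α, β, γ`. -/
structure IsGeneralizedPseudoHessian (D : Connection n M) (h : Bivector n M) : Prop where
  smooth_connection : ContMDiffCovariantDerivativeOn (Model n) ∞ D.toFun (Set.univ : Set M)
  torsion_eq_zero : D.torsion = 0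
  flat : IsFlat D
  smooth_bivector : SmoothBivector h
  symm : ∀ p α β, h p α β = h p β α
  codazzi : ∀ α β γ : OneForm n M, SmoothOneForm α → SmoothOneForm β → SmoothOneForm γ →
    ∀ p, covDeriv D h p (sharp h p (α p)) β γ = covDeriv D h p (sharp h p (β p)) α γ

/-- The coordinate vector field `∂_{x_i}` of the chart `φ` (meaningful on `φ.source`). -/
def coordField (φ : OpenPartialHomeomorph M (Model n)) (i : Fin n) : VField n M :=
  VectorField.mpullback (𝓡 n) (𝓡 n) φ (fun _ ↦ EuclideanSpace.single i (1 : ℝ))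

/-- The second partial derivative `∂²f / ∂x_i ∂x_j` at `z`. -/
def partial₂ (f : Model n → ℝ) (i j : Fin n) (z : Model n) : ℝ :=
  fderiv ℝ (fun w ↦ fderiv ℝ f w (EuclideanSpace.single j 1)) z (EuclideanSpace.single i 1)

end

end GPH

/-!
The theorem says that near a point of locally constant rank a generalized pseudo-Hessian structure
is, on each leaf of the distribution `range h_#`, an ordinary pseudo-Hessian structure, and that the
coordinates and the potentials of the leaves can be chosen to depend smoothly on the leaf.

A flat torsion-free connection has affine coordinates (`exists_affine_chart`): parallel transport
along the rays from a point gives a parallel coframe because the curvature vanishes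
(`exists_parallel_frame`), and the coframe is closed because the torsion vanishes. In affine
coordinates, with the model space `E` identified with its dual by the inner product, `h_#` is a
field `S` of symmetric operators of constant rank, and the Codazzi equation reads
`dS(S a) b = dS(S b) a`. The affine coordinates are chosen such that at the base point the range of
`S` is that of the orthogonal projection `π` onto the first `r` basis vectors.

Near the base point the compression `π S π` is invertible on the range of `π`; let `Q` be its
inverse, extended by zero (`IsCompressedInverse`). Then `X = S Q` is the projection onto `range S`
along `ker π`. The Codazzi equation yields `dX(X a) = 0` (`fderiv_mul_apply_eq_zero`), so `X` is
constant along the leaves and the leaves are affine. The map `w ↦ (w - π w) + X (w - π w) w` is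
therefore the inverse of a chart whose coordinate vectors in the directions of `range π` are the
vectors `X a`. They are parallel along the leaves, and in this chart `h` has the matrix `π S π`. The
Codazzi equation also says that `Q`, as a one-form along the leaves with values in `E`, is closed.
The Poincaré lemma with parameters (`exists_partial_primitive`), used twice, expresses `Q` as the
second derivative of a function along the leaves (`exists_hessian_chart_of_codazzi`). Undoing the
affine chart gives `exists_hessian_chart`, the statement of the theorem in an arbitrary chart.

The passage to the manifold is the computation of `∇`, of its torsion and curvature, and of the
Codazzi equation in a chart. The hypotheses concern fields defined on all of `M`, so the constant
fields of the chart are extended by means of bump functions (`exists_isExtensionDomain`).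
-/

open MeasureTheory Set

universe u

/-! ### Smooth primitives, inverse functions and constancy along leaves -/

theorem hasFDerivAt_integral_param {E F : Type u} [NormedAddCommGroup E] [NormedSpace ℝ E]
    [FiniteDimensional ℝ E] [NormedAddCommGroup F] [NormedSpace ℝ F]
    {G : E × ℝ → F} (hG : ContDiff ℝ ∞ G) (x : E) :
    HasFDerivAt (fun x ↦ ∫ t in (0 : ℝ)..1, G (x, t))
      (∫ t in (0 : ℝ)..1, fderiv ℝ G (x, t) ∘L ContinuousLinearMap.inl ℝ E ℝ) x := by
  have hc : Continuous G := hG.continuous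
  have hc' : Continuous fun p : E × ℝ ↦ fderiv ℝ G p ∘L ContinuousLinearMap.inl ℝ E ℝ :=
    (hG.continuous_fderiv (by simp)).clm_comp continuous_const
  have hK : IsCompact (Metric.closedBall x 1 ×ˢ Icc (0 : ℝ) 1) :=
    (isCompact_closedBall x 1).prod isCompact_Icc
  obtain ⟨C, hC⟩ := hK.exists_bound_of_continuousOn hc'.continuousOn
  refine intervalIntegral.hasFDerivAt_integral_of_dominated_of_fderiv_le (bound := fun _ ↦ C)
    (F' := fun x t ↦ fderiv ℝ G (x, t) ∘L ContinuousLinearMap.inl ℝ E ℝ)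
    (Metric.closedBall_mem_nhds x one_pos) ?_ ?_ ?_ ?_ ?_ ?_
  · exact Filter.Eventually.of_forall fun y ↦
      (hc.comp (by fun_prop : Continuous fun t : ℝ ↦ (y, t))).aestronglyMeasurable
  · exact (hc.comp (by fun_prop : Continuous fun t : ℝ ↦ (x, t))).intervalIntegrable _ _
  · exact (hc'.comp (by fun_prop : Continuous fun t : ℝ ↦ (x, t))).aestronglyMeasurable
  · refine Filter.Eventually.of_forall fun t ht y hy ↦ hC (y, t) ⟨hy, ?_⟩
    rw [uIoc_of_le zero_le_one] at ht
    exact ⟨ht.1.le, ht.2⟩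
  · exact intervalIntegrable_const
  · refine Filter.Eventually.of_forall fun t _ y _ ↦ ?_
    have h1 : HasFDerivAt G (fderiv ℝ G (y, t)) (y, t) :=
      (hG.differentiable (by simp) _).hasFDerivAt
    exact h1.comp y (hasFDerivAt_prodMk_left y t)

theorem contDiff_integral_param {E F : Type u} [NormedAddCommGroup E] [NormedSpace ℝ E]
    [FiniteDimensional ℝ E] [NormedAddCommGroup F] [NormedSpace ℝ F]
    {G : E × ℝ → F} (hG : ContDiff ℝ ∞ G) :
    ContDiff ℝ ∞ fun x ↦ ∫ t in (0 : ℝ)..1, G (x, t) := by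
  rw [contDiff_infty]
  intro m
  induction m generalizing F with
  | zero =>
    refine contDiff_zero.2 ?_
    exact intervalIntegral.continuous_parametric_intervalIntegral_of_continuous'
      (f := fun x t ↦ G (x, t)) hG.continuous 0 1
  | succ m ih =>
    refine (contDiff_succ_iff_hasFDerivAt (n := m)).2
      ⟨fun x ↦ ∫ t in (0 : ℝ)..1, fderiv ℝ G (x, t) ∘L ContinuousLinearMap.inl ℝ E ℝ, ?_,
        hasFDerivAt_integral_param hG⟩
    exact ih (G := fun p ↦ fderiv ℝ G p ∘L ContinuousLinearMap.inl ℝ E ℝ)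
      ((hG.fderiv_right (m := ∞) (by simp)).clm_comp contDiff_const)

/-- A function that is smooth on a ball agrees with a globally smooth one on the ball of half the
radius. -/
theorem exists_contDiff_eqOn_ball {E F : Type*} [NormedAddCommGroup E] [NormedSpace ℝ E]
    [FiniteDimensional ℝ E] [NormedAddCommGroup F] [NormedSpace ℝ F]
    {g : E → F} {R : ℝ} (hR : 0 < R) (hg : ContDiffOn ℝ ∞ g (Metric.ball 0 R)) :
    ∃ g' : E → F, ContDiff ℝ ∞ g' ∧ EqOn g' g (Metric.ball 0 (R / 2)) := by
  let b : ContDiffBump (0 : E) := ⟨R / 2, 3 * R / 4, by positivity, by linarith⟩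
  refine ⟨fun x ↦ b x • g x, contDiff_iff_contDiffAt.2 fun x ↦ ?_, fun x hx ↦ ?_⟩
  · by_cases hx : x ∈ Metric.ball (0 : E) R
    · exact b.contDiffAt.smul (hg.contDiffAt (Metric.isOpen_ball.mem_nhds hx))
    · have hx' : x ∉ tsupport b := by
        rw [b.tsupport_eq]
        simp only [Metric.mem_ball, Metric.mem_closedBall, dist_zero_right, not_lt, not_le] at hx ⊢
        change 3 * R / 4 < _
        linarith
      have h0 : (fun x ↦ b x • g x) =ᶠ[𝓝 x] fun _ ↦ 0 := by
        filter_upwards [notMem_tsupport_iff_eventuallyEq.1 hx'] with y hy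
        simp [hy]
      exact contDiffAt_const.congr_of_eventuallyEq h0
  · simp [b.one_of_mem_closedBall (Metric.ball_subset_closedBall hx)]

/-- Poincaré lemma along the fibres of the projection `1 - π`, with smooth dependence on the
transverse parameter. -/
theorem exists_partial_primitive {E F : Type u} [NormedAddCommGroup E] [NormedSpace ℝ E]
    [FiniteDimensional ℝ E] [NormedAddCommGroup F] [NormedSpace ℝ F] [CompleteSpace F]
    {π : E →L[ℝ] E} (hπ : ∀ v, π (π v) = π v) {θ : E → E →L[ℝ] F} (hθ : ContDiff ℝ ∞ θ)
    {s : Set E} (hs : ∀ w ∈ s, ∀ t ∈ Icc (0 : ℝ) 1, w - π w + t • π w ∈ s)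
    (hsymm : ∀ w ∈ s, ∀ a b, fderiv ℝ θ w (π a) (π b) = fderiv ℝ θ w (π b) (π a)) :
    ∃ f : E → F, ContDiff ℝ ∞ f ∧ ∀ w ∈ s, ∀ v, fderiv ℝ f w (π v) = θ w (π v) := by
  let G : E × ℝ → F := fun p ↦ θ (p.1 - π p.1 + p.2 • π p.1) (π p.1)
  have hγ : ContDiff ℝ ∞ fun p : E × ℝ ↦ p.1 - π p.1 + p.2 • π p.1 := by fun_prop
  have hG : ContDiff ℝ ∞ G := (hθ.comp hγ).clm_apply (by fun_prop)
  -- the primitive is the line integral of `θ` from `w - π w` to `w`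
  refine ⟨_, contDiff_integral_param hG, fun w hw v ↦ ?_⟩
  rw [(hasFDerivAt_integral_param hG w).fderiv]
  have hc' : Continuous fun t : ℝ ↦ fderiv ℝ G (w, t) ∘L ContinuousLinearMap.inl ℝ E ℝ :=
    ((hG.continuous_fderiv (by simp)).comp (by fun_prop)).clm_comp continuous_const
  rw [ContinuousLinearMap.intervalIntegral_apply (hc'.intervalIntegrable _ _)]
  have hθd : ∀ z, HasFDerivAt θ (fderiv ℝ θ z) z := fun z ↦
    (hθ.differentiable (by simp) z).hasFDerivAt
  -- the integrand is the derivative of `t ↦ t • θ (w - π w + t • π w) (π v)`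
  have key : ∀ t ∈ Icc (0 : ℝ) 1, HasDerivAt (fun t : ℝ ↦ t • θ (w - π w + t • π w) (π v))
      ((fderiv ℝ G (w, t) ∘L ContinuousLinearMap.inl ℝ E ℝ) (π v)) t := by
    intro t ht
    have hz := hs w hw t ht
    have h1 : HasFDerivAt (fun x : E ↦ θ (x - π x + t • π x) (π x))
        (fderiv ℝ G (w, t) ∘L ContinuousLinearMap.inl ℝ E ℝ) w := by
      have h0 : HasFDerivAt G (fderiv ℝ G (w, t)) (w, t) :=
        (hG.differentiable (by simp) _).hasFDerivAt
      have := h0.comp (f := fun e : E ↦ (e, t)) w (hasFDerivAt_prodMk_left w t)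
      exact this
    have h2 : HasFDerivAt (fun x : E ↦ x - π x + t • π x)
        (ContinuousLinearMap.id ℝ E - π + t • π) w :=
      ((hasFDerivAt_id w).sub π.hasFDerivAt).add (π.hasFDerivAt.const_smul t)
    have h3 := ((hθd _).comp w h2).clm_apply π.hasFDerivAt
    rw [h1.unique h3]
    have h4 : HasDerivAt (fun t : ℝ ↦ w - π w + t • π w) (π w) t := by
      simpa using ((hasDerivAt_id t).smul_const (π w)).const_add (w - π w)
    have h5 : HasDerivAt (fun t : ℝ ↦ θ (w - π w + t • π w) (π v))
        (fderiv ℝ θ (w - π w + t • π w) (π w) (π v)) t := by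
      have := ((hθd _).comp_hasDerivAt t h4).clm_apply (hasDerivAt_const t (π v))
      simpa using this
    have h6 : HasDerivAt (fun t : ℝ ↦ t • θ (w - π w + t • π w) (π v)) _ t :=
      (hasDerivAt_id t).smul h5
    refine h6.congr_deriv ?_
    change t • fderiv ℝ θ (w - π w + t • π w) (π w) (π v) +
      (1 : ℝ) • θ (w - π w + t • π w) (π v) = θ (w - π w + t • π w) (π (π v)) +
      fderiv ℝ θ (w - π w + t • π w) (π v - π (π v) + t • π (π v)) (π w)
    rw [hπ, sub_self, zero_add, map_smul, smul_apply, hsymm _ hz v w, one_smul, add_comm]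
  rw [intervalIntegral.integral_eq_sub_of_hasDerivAt
    (by rw [uIcc_of_le zero_le_one]; exact key)
    ((hc'.clm_apply continuous_const).intervalIntegrable _ _)]
  simp

/-- The inverse function theorem, with both directions smooth on the whole domain. -/
theorem exists_openPartialHomeomorph_eq {E : Type*} [NormedAddCommGroup E] [NormedSpace ℝ E]
    [CompleteSpace E] {F : E → E} {O : Set E} (hO : IsOpen O) (hF : ContDiffOn ℝ ∞ F O) {x : E}
    (hx : x ∈ O) {F' : E ≃L[ℝ] E} (hF' : HasFDerivAt F (F' : E →L[ℝ] E) x) :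
    ∃ ψ : OpenPartialHomeomorph E E, x ∈ ψ.source ∧ ψ.source ⊆ O ∧ ⇑ψ = F ∧
      ContDiffOn ℝ ∞ ψ.symm ψ.target ∧ ∀ z ∈ ψ.source, (fderiv ℝ F z).IsInvertible := by
  have hFx : ContDiffAt ℝ ∞ F x := hF.contDiffAt (hO.mem_nhds hx)
  let ψ₀ := hFx.toOpenPartialHomeomorph F hF' (by simp)
  -- Mathlib's local inverse is smooth at `F x` only; shrinking the source to the points with
  -- invertible derivative makes it smooth everywhere
  let s : Set E := O ∩ fderiv ℝ F ⁻¹' range ((↑) : (E ≃L[ℝ] E) → E →L[ℝ] E)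
  have hs : IsOpen s := (hF.continuousOn_fderiv_of_isOpen hO (by simp)).isOpen_inter_preimage hO
    (ContinuousLinearEquiv.isOpen)
  have hcoe : ⇑ψ₀ = F := hFx.toOpenPartialHomeomorph_coe hF' (by simp)
  have hxs : x ∈ s := ⟨hx, F', by rw [hF'.fderiv]⟩
  refine ⟨ψ₀.restrOpen s hs, ⟨hFx.mem_toOpenPartialHomeomorph_source hF' (by simp), hxs⟩,
    fun z hz ↦ hz.2.1, hcoe, fun y hy ↦ ?_, fun z hz ↦ hz.2.2⟩
  have hz : (ψ₀.restrOpen s hs).symm y ∈ (ψ₀.restrOpen s hs).source :=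
    (ψ₀.restrOpen s hs).map_target hy
  obtain ⟨L, hL⟩ := hz.2.2
  have hFz : ContDiffAt ℝ ∞ F ((ψ₀.restrOpen s hs).symm y) := hF.contDiffAt (hO.mem_nhds hz.2.1)
  refine ((ψ₀.restrOpen s hs).contDiffAt_symm (f₀' := L) hy ?_ ?_).contDiffWithinAt
  · change HasFDerivAt ψ₀ _ _
    rw [hcoe, hL]
    exact (hFz.differentiableAt (by simp)).hasFDerivAt
  · change ContDiffAt ℝ ∞ ψ₀ _
    rw [hcoe]
    exact hFz

/-- If the derivative of `X` in the direction `X z a` vanishes, then `X` is constant on the segment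
from `c` to `c + X c a`. This segment is a priori not tangent to `z ↦ X z a`, and Gronwall's
inequality for `X - X c` shows that it is. -/
theorem eq_of_forall_fderiv_apply_self_eq_zero {E : Type*} [NormedAddCommGroup E]
    [NormedSpace ℝ E] {X : E → E →L[ℝ] E} {s : Set E} (hs : IsOpen s) (hX : ContDiffOn ℝ ∞ X s)
    {c a : E} (hseg : ∀ t ∈ Icc (0 : ℝ) 1, c + t • X c a ∈ s)
    (h : ∀ z ∈ s, fderiv ℝ X z (X z a) = 0) :
    X (c + X c a) = X c := by
  let γ : ℝ → E := fun t ↦ c + t • X c a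
  have hγ : Continuous γ := by fun_prop
  have hd : ∀ t ∈ Icc (0 : ℝ) 1, HasDerivAt (fun t ↦ X (γ t) - X c)
      (fderiv ℝ X (γ t) (X c a)) t := by
    intro t ht
    have h1 : HasDerivAt γ (X c a) t := by
      simpa [γ] using ((hasDerivAt_id t).smul_const (X c a)).const_add c
    have h2 := ((hX.contDiffAt (hs.mem_nhds (hseg t ht))).differentiableAt (by simp)).hasFDerivAt
    exact (h2.comp_hasDerivAt t h1).sub_const _
  obtain ⟨C, hC⟩ := isCompact_Icc.exists_bound_of_continuousOn
    ((hX.continuousOn_fderiv_of_isOpen hs (by simp)).comp hγ.continuousOn hseg)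
  have key := eq_zero_of_abs_deriv_le_mul_abs_self_of_eq_zero_right (a := (0 : ℝ)) (b := 1)
    (f := fun t ↦ X (γ t) - X c) (f' := fun t ↦ fderiv ℝ X (γ t) (X c a)) (K := C * ‖a‖)
    (fun t ht ↦ (hd t ht).continuousAt.continuousWithinAt)
    (fun t ht ↦ (hd t ⟨ht.1, ht.2.le⟩).hasDerivWithinAt) (by simp [γ]) ?_ 1 (by simp)
  · simpa [γ, sub_eq_zero] using key
  · intro t ht
    have ht' : t ∈ Icc (0 : ℝ) 1 := ⟨ht.1, ht.2.le⟩
    have h1 : fderiv ℝ X (γ t) (X c a) = - fderiv ℝ X (γ t) ((X (γ t) - X c) a) := by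
      rw [sub_apply, map_sub, (h _ (hseg t ht') : fderiv ℝ X (γ t) (X (γ t) a) = 0), zero_sub,
        neg_neg]
    rw [h1, norm_neg]
    calc _ ≤ ‖fderiv ℝ X (γ t)‖ * (‖X (γ t) - X c‖ * ‖a‖) :=
          (ContinuousLinearMap.le_opNorm _ _).trans
            (mul_le_mul_of_nonneg_left (ContinuousLinearMap.le_opNorm _ _) (norm_nonneg _))
      _ ≤ C * (‖X (γ t) - X c‖ * ‖a‖) := by
          gcongr
          exact hC t ht'
      _ = _ := by ring

/-! ### Parallel frames of flat connections -/

/-- Second order Taylor estimate, uniform on a ball. -/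
theorem exists_taylor_bound {E F : Type*} [NormedAddCommGroup E] [NormedSpace ℝ E]
    [FiniteDimensional ℝ E] [NormedAddCommGroup F] [NormedSpace ℝ F] {g : E → F}
    (hg : ContDiff ℝ ∞ g) (r : ℝ) :
    ∃ C, 0 ≤ C ∧ ∀ x ∈ Metric.closedBall (0 : E) r, ‖g x‖ ≤ C ∧ ‖fderiv ℝ g x‖ ≤ C ∧
      ∀ y ∈ Metric.closedBall (0 : E) r,
        ‖g y - g x - fderiv ℝ g x (y - x)‖ ≤ C * ‖y - x‖ ^ 2 := by
  have hK := isCompact_closedBall (0 : E) r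
  have hg' : ContDiff ℝ ∞ (fderiv ℝ g) := hg.fderiv_right (by simp)
  obtain ⟨C₀, hC₀⟩ := hK.exists_bound_of_continuousOn hg.continuous.continuousOn
  obtain ⟨C₁, hC₁⟩ := hK.exists_bound_of_continuousOn hg'.continuous.continuousOn
  obtain ⟨C₂, hC₂⟩ := hK.exists_bound_of_continuousOn
    (hg'.continuous_fderiv (by simp)).continuousOn
  refine ⟨max 0 (max C₀ (max C₁ C₂)), le_max_left _ _, fun x hx ↦
    ⟨(hC₀ x hx).trans (by simp), (hC₁ x hx).trans (by simp), fun y hy ↦ ?_⟩⟩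
  set C := max 0 (max C₀ (max C₁ C₂))
  have hC : C₂ ≤ C := by simp [C]
  have hC0 : 0 ≤ C := le_max_left _ _
  have hseg : segment ℝ x y ⊆ Metric.closedBall (0 : E) r :=
    (convex_closedBall _ _).segment_subset hx hy
  have h1 : ∀ z ∈ segment ℝ x y, ‖fderiv ℝ g z - fderiv ℝ g x‖ ≤ C * ‖y - x‖ := by
    intro z hz
    refine ((convex_closedBall (0 : E) r).norm_image_sub_le_of_norm_fderiv_le
      (fun w _ ↦ hg'.differentiable (by simp) w) (fun w hw ↦ (hC₂ w hw).trans hC) hx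
      (hseg hz)).trans ?_
    gcongr
    rw [← dist_eq_norm, ← dist_eq_norm, dist_comm z x, dist_comm y x]
    obtain ⟨a, b, ha, hb, hab, rfl⟩ := hz
    rw [dist_eq_norm, dist_eq_norm, show x - (a • x + b • y) = b • (x - y) by
      rw [← eq_sub_iff_add_eq] at hab; rw [hab]; module, norm_smul, Real.norm_of_nonneg hb]
    exact mul_le_of_le_one_left (norm_nonneg _) (by linarith)
  refine ((convex_segment x y).norm_image_sub_le_of_norm_fderiv_le'
    (fun w _ ↦ hg.differentiable (by simp) w) h1 (left_mem_segment ℝ x y)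
    (right_mem_segment ℝ x y)).trans_eq (by ring)

section

variable {E A : Type*} [NormedAddCommGroup E] [NormedSpace ℝ E] [NormedRing A]
  [NormedAlgebra ℝ A]

/-- Parallel transport along short rays from the origin. The smallness of `Γ (t • x) x` makes the
Picard iteration converge on all of `[0, 1]`. -/
theorem exists_ray_solution [CompleteSpace A] {Γ : E → E →L[ℝ] A} (hΓ : Continuous Γ) {x : E}
    (hx : ∀ t ∈ Icc (0 : ℝ) 1, ‖Γ (t • x) x‖ * (‖(1 : A)‖ + 1) ≤ 1) :
    ∃ Y : ℝ → A, Y 0 = 1 ∧ ∀ t ∈ Icc (0 : ℝ) 1,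
      HasDerivWithinAt Y (Y t * Γ (t • x) x) (Icc 0 1) t := by
  have hle : ∀ t ∈ Icc (0 : ℝ) 1, ‖Γ (t • x) x‖ ≤ 1 := fun t ht ↦ by
    nlinarith [hx t ht, norm_nonneg (1 : A), norm_nonneg (Γ (t • x) x)]
  have hf : IsPicardLindelof (fun (t : ℝ) (Y : A) ↦ Y * Γ (t • x) x)
      (⟨0, by simp⟩ : Icc (0 : ℝ) 1) (1 : A) 1 0 1 1 := by
    constructor
    · intro t ht
      refine LipschitzOnWith.of_dist_le_mul fun Y _ Z _ ↦ ?_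
      rw [dist_eq_norm, dist_eq_norm, ← sub_mul, NNReal.coe_one, one_mul]
      exact (norm_mul_le _ _).trans (mul_le_of_le_one_right (norm_nonneg _) (hle t ht))
    · intro Y _
      have : Continuous fun t : ℝ ↦ Y * Γ (t • x) x :=
        continuous_const.mul ((hΓ.comp (by fun_prop)).clm_apply continuous_const)
      exact this.continuousOn
    · intro t ht Y hY
      have h1 : ‖Y‖ ≤ ‖(1 : A)‖ + 1 := by
        have h2 : ‖Y - 1‖ ≤ 1 := by simpa [dist_eq_norm] using hY
        have h3 := norm_add_le (Y - 1) 1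
        rw [sub_add_cancel] at h3
        linarith
      calc _ ≤ ‖Y‖ * ‖Γ (t • x) x‖ := norm_mul_le _ _
        _ ≤ (‖(1 : A)‖ + 1) * ‖Γ (t • x) x‖ := by gcongr
        _ ≤ 1 := by linarith [hx t ht]
    · simp
  exact hf.exists_eq_forall_mem_Icc_hasDerivWithinAt₀

/-- If `Γ` has zero curvature along the ray through `x`, then parallel transport along the ray
through a nearby `y` agrees with the first order guess built from parallel transport along the ray
through `x`, up to an error of order `‖y - x‖ ^ 2`. -/
theorem ray_solution_sub_le {Γ : E → E →L[ℝ] A} (hΓ : ContDiff ℝ ∞ Γ) {x y : E} {C M : ℝ}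
    {Y Z : ℝ → A} (hC0 : 0 ≤ C) (hx1 : ‖x‖ ≤ 1) (hxy1 : ‖y - x‖ ≤ 1)
    (hflat : ∀ t ∈ Icc (0 : ℝ) 1, ∀ v w, fderiv ℝ Γ (t • x) v w - fderiv ℝ Γ (t • x) w v
      + Γ (t • x) v * Γ (t • x) w - Γ (t • x) w * Γ (t • x) v = 0)
    (hC : ∀ t ∈ Icc (0 : ℝ) 1, ‖Γ (t • x)‖ ≤ C ∧ ‖fderiv ℝ Γ (t • x)‖ ≤ C ∧
      ‖Γ (t • y) - Γ (t • x) - fderiv ℝ Γ (t • x) (t • y - t • x)‖ ≤ C * ‖t • y - t • x‖ ^ 2)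
    (hy : ∀ t ∈ Icc (0 : ℝ) 1, ‖Γ (t • y) y‖ ≤ 1)
    (hY0 : Y 0 = 1) (hY : ∀ t ∈ Icc (0 : ℝ) 1,
      HasDerivWithinAt Y (Y t * Γ (t • x) x) (Icc 0 1) t)
    (hZ0 : Z 0 = 1) (hZ : ∀ t ∈ Icc (0 : ℝ) 1,
      HasDerivWithinAt Z (Z t * Γ (t • y) y) (Icc 0 1) t)
    (hM : ∀ t ∈ Icc (0 : ℝ) 1, ‖Y t‖ ≤ M) :
    ‖Z 1 - Y 1 - Y 1 * Γ x (y - x)‖ ≤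
      M * (3 * C + 5 * C ^ 2) * (Real.exp 1 - 1) * ‖y - x‖ ^ 2 := by
  set v := y - x with hv
  have hyx : y = x + v := by simp [v]
  have hv0 := norm_nonneg v
  have hM0 : 0 ≤ M := (norm_nonneg _).trans (hM 0 (by simp))
  have hΓd : ∀ z, HasFDerivAt Γ (fderiv ℝ Γ z) z := fun z ↦
    (hΓ.differentiable (by simp) z).hasFDerivAt
  -- the first order guess for `Z`
  let g : ℝ → A := fun t ↦ Y t + Y t * (t • Γ (t • x) v)
  have hg : ∀ t ∈ Icc (0 : ℝ) 1, HasDerivWithinAt g (Y t * Γ (t • x) x +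
      ((Y t * Γ (t • x) x) * (t • Γ (t • x) v) +
        Y t * (t • fderiv ℝ Γ (t • x) x v + Γ (t • x) v))) (Icc 0 1) t := by
    intro t ht
    have h1 : HasDerivAt (fun t : ℝ ↦ t • x) x t := by
      simpa using (hasDerivAt_id t).smul_const x
    have h2 : HasDerivAt (fun t : ℝ ↦ Γ (t • x) v) (fderiv ℝ Γ (t • x) x v) t := by
      have := ((hΓd _).comp_hasDerivAt t h1).clm_apply (hasDerivAt_const t v)
      simpa using this
    have h3 : HasDerivAt (fun t : ℝ ↦ t • Γ (t • x) v)
        (t • fderiv ℝ Γ (t • x) x v + Γ (t • x) v) t := by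
      have : HasDerivAt (fun t : ℝ ↦ t • Γ (t • x) v)
          (t • fderiv ℝ Γ (t • x) x v + (1 : ℝ) • Γ (t • x) v) t := (hasDerivAt_id t).smul h2
      simpa using this
    exact (hY t ht).add ((hY t ht).mul h3.hasDerivWithinAt)
  have hIci : ∀ {f : ℝ → A} {f' : A} {t : ℝ}, t ∈ Ico (0 : ℝ) 1 →
      HasDerivWithinAt f f' (Icc 0 1) t → HasDerivWithinAt f f' (Ici t) t := by
    intro f f' t ht h
    refine h.mono_of_mem_nhdsWithin ?_
    exact mem_nhdsWithin.2 ⟨Iio 1, isOpen_Iio, ht.2, fun s hs ↦ ⟨ht.1.trans hs.2, hs.1.le⟩⟩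
  have key := dist_le_of_approx_trajectories_ODE_of_mem (a := (0 : ℝ)) (b := 1) (K := 1) (δ := 0)
    (v := fun t Y ↦ Y * Γ (t • y) y) (s := fun _ ↦ univ) (f := Z) (g := g) (εf := 0)
    (εg := M * (3 * C + 5 * C ^ 2) * ‖v‖ ^ 2)
    (f' := fun t ↦ Z t * Γ (t • y) y)
    (g' := fun t ↦ Y t * Γ (t • x) x + ((Y t * Γ (t • x) x) * (t • Γ (t • x) v) +
        Y t * (t • fderiv ℝ Γ (t • x) x v + Γ (t • x) v)))
    ?_ (fun t ht ↦ (hZ t ht).continuousWithinAt)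
    (fun t ht ↦ hIci ht (hZ t ⟨ht.1, ht.2.le⟩)) (by simp) (by simp)
    (fun t ht ↦ (hg t ht).continuousWithinAt)
    (fun t ht ↦ hIci ht (hg t ⟨ht.1, ht.2.le⟩)) ?_ (by simp) (by simp [g, hY0, hZ0]) 1 (by simp)
  · rw [dist_eq_norm, gronwallBound_of_K_ne_0 (by simp)] at key
    simp only [g, one_smul] at key
    rw [sub_sub]
    refine key.trans_eq ?_
    norm_num
    ring
  · intro t ht
    refine LipschitzOnWith.of_dist_le_mul fun U _ V _ ↦ ?_
    rw [dist_eq_norm, dist_eq_norm, ← sub_mul, NNReal.coe_one, one_mul]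
    exact (norm_mul_le _ _).trans
      (mul_le_of_le_one_right (norm_nonneg _) (hy t ⟨ht.1, ht.2.le⟩))
  · intro t ht
    have ht' : t ∈ Icc (0 : ℝ) 1 := ⟨ht.1, ht.2.le⟩
    obtain ⟨hC1, hC2, hC3⟩ := hC t ht'
    have hfl := hflat t ht' x v
    set T := fderiv ℝ Γ (t • x)
    set G := Γ (t • x)
    set E₁ := Γ (t • y) - G - T (t • y - t • x) with hE₁
    have htv : t • y - t • x = t • v := by rw [hv, smul_sub]
    have hΓy : Γ (t • y) = G + t • T v + E₁ := by
      rw [hE₁, htv, map_smul]; abel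
    have hE₁' : ‖E₁‖ ≤ C * ‖v‖ ^ 2 := by
      refine hC3.trans ?_
      rw [htv, norm_smul, Real.norm_of_nonneg ht'.1]
      gcongr
      · exact mul_nonneg ht'.1 hv0
      · exact mul_le_of_le_one_left hv0 ht'.2
    have ht1 : ‖t‖ ≤ 1 := by rw [Real.norm_of_nonneg ht'.1]; exact ht'.2
    have hsm : ∀ a : A, ‖t • a‖ ≤ ‖a‖ := fun a ↦ by
      rw [norm_smul]; exact mul_le_of_le_one_left (norm_nonneg _) ht1
    have hyn : ‖y‖ ≤ 2 := by
      rw [hyx]; exact (norm_add_le _ _).trans (by linarith)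
    -- the part of `Γ (t • y) y` that is of second order in `v`
    set P := t • T v v + E₁ y with hP
    have hTv : ∀ w, ‖T v w‖ ≤ C * ‖v‖ * ‖w‖ := fun w ↦ by
      refine ((T v).le_opNorm w).trans ?_
      gcongr
      exact (T.le_opNorm v).trans (by gcongr)
    have hGv : ‖G v‖ ≤ C * ‖v‖ := (G.le_opNorm v).trans (by gcongr)
    have hPn : ‖P‖ ≤ 3 * C * ‖v‖ ^ 2 := by
      refine (norm_add_le _ _).trans ?_
      have h1 := (hsm _).trans (hTv v)
      have h2 : ‖E₁ y‖ ≤ C * ‖v‖ ^ 2 * 2 := (E₁.le_opNorm y).trans (by gcongr)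
      linarith
    have hTx : ‖t • T v x + P‖ ≤ 4 * C * ‖v‖ := by
      refine (norm_add_le _ _).trans ?_
      have h1 := (hsm _).trans (hTv x)
      have h2 : C * ‖v‖ * ‖x‖ ≤ C * ‖v‖ * 1 := by gcongr
      have h3 : 3 * C * ‖v‖ ^ 2 ≤ 3 * C * ‖v‖ := by
        rw [pow_two]
        exact mul_le_mul_of_nonneg_left (mul_le_of_le_one_left hv0 hxy1) (by positivity)
      linarith
    -- zero curvature cancels the first order part of the defect `g' - g * Γ (t • y) y`
    have hmain : Y t * G x + ((Y t * G x) * (t • G v) + Y t * (t • T x v + G v))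
        - g t * Γ (t • y) y
        = - (Y t * (P + t • G v * (t • T v x + P + G v))) := by
      have h1 : Γ (t • y) y = G x + G v + t • T v x + P := by
        rw [hΓy, hP]
        simp only [hyx, add_apply, smul_apply, map_add]
        abel
      have h2 : T x v = T v x - G x * G v + G v * G x := by
        rw [← sub_eq_zero, ← hfl]; abel
      rw [h1, h2]
      simp only [g, G, mul_add, add_mul, smul_add, smul_sub, mul_sub, mul_smul_comm,
        smul_mul_assoc, mul_assoc]
      abel
    rw [dist_eq_norm, hmain, norm_neg]
    calc _ ≤ ‖Y t‖ * (‖P‖ + ‖t • G v‖ * (‖t • T v x + P‖ + ‖G v‖)) := by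
          refine (norm_mul_le _ _).trans ?_
          gcongr
          refine (norm_add_le _ _).trans ?_
          gcongr
          refine (norm_mul_le _ _).trans ?_
          gcongr
          exact norm_add_le _ _
      _ ≤ M * (3 * C * ‖v‖ ^ 2 + C * ‖v‖ * (4 * C * ‖v‖ + C * ‖v‖)) := by
          gcongr
          · exact hM t ht'
          · exact (hsm _).trans hGv
      _ = _ := by ring

/-- A connection form `Γ` with zero curvature has a parallel frame `F` near the origin, which means
that `dF = F Γ`. The value `F x` is the parallel transport along the ray from the origin to `x`, and
`ray_solution_sub_le` computes its derivative. -/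
theorem exists_parallel_frame [FiniteDimensional ℝ E] [CompleteSpace A] {Γ : E → E →L[ℝ] A}
    (hΓ : ContDiff ℝ ∞ Γ) {R : ℝ} (hR : 0 < R)
    (hflat : ∀ x ∈ Metric.ball (0 : E) R, ∀ v w, fderiv ℝ Γ x v w - fderiv ℝ Γ x w v
      + Γ x v * Γ x w - Γ x w * Γ x v = 0) :
    ∃ r > 0, ∃ F : E → A, F 0 = 1 ∧ ∀ x ∈ Metric.ball (0 : E) r,
      HasFDerivAt F (ContinuousLinearMap.mul ℝ A (F x) ∘L Γ x) x := by
  obtain ⟨C, hC0, hC⟩ := exists_taylor_bound hΓ 1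
  let r : ℝ := min (min (1 / 2) R) (1 / ((C + 1) * (‖(1 : A)‖ + 1)))
  have hr : 0 < r := by positivity
  have hr2 : r ≤ 1 / 2 := (min_le_left _ _).trans (min_le_left _ _)
  have hrR : r ≤ R := (min_le_left _ _).trans (min_le_right _ _)
  have hmem : ∀ x ∈ Metric.ball (0 : E) r, ∀ t ∈ Icc (0 : ℝ) 1, ‖t • x‖ < r := by
    intro x hx t ht
    rw [norm_smul, Real.norm_of_nonneg ht.1]
    exact (mul_le_of_le_one_left (norm_nonneg _) ht.2).trans_lt (by simpa using hx)
  have hmem1 : ∀ x ∈ Metric.ball (0 : E) r, ∀ t ∈ Icc (0 : ℝ) 1,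
      t • x ∈ Metric.closedBall (0 : E) 1 := by
    intro x hx t ht
    simpa using (hmem x hx t ht).le.trans (by linarith)
  have hsmall : ∀ x ∈ Metric.ball (0 : E) r, ∀ t ∈ Icc (0 : ℝ) 1,
      ‖Γ (t • x) x‖ * (‖(1 : A)‖ + 1) ≤ 1 := by
    intro x hx t ht
    have h1 : ‖Γ (t • x) x‖ ≤ (C + 1) * r := by
      refine ((Γ (t • x)).le_opNorm x).trans ?_
      gcongr
      · exact (hC _ (hmem1 x hx t ht)).1.trans (by linarith)
      · exact (by simpa using hx : ‖x‖ < r).le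
    calc _ ≤ (C + 1) * r * (‖(1 : A)‖ + 1) := by gcongr
      _ = r * ((C + 1) * (‖(1 : A)‖ + 1)) := by ring
      _ ≤ 1 / ((C + 1) * (‖(1 : A)‖ + 1)) * ((C + 1) * (‖(1 : A)‖ + 1)) := by
          gcongr
          exact min_le_right _ _
      _ = 1 := by field_simp
  have hex : ∀ x, ∃ Y : ℝ → A, x ∈ Metric.ball (0 : E) r → Y 0 = 1 ∧ ∀ t ∈ Icc (0 : ℝ) 1,
      HasDerivWithinAt Y (Y t * Γ (t • x) x) (Icc 0 1) t := by
    intro x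
    by_cases hx : x ∈ Metric.ball (0 : E) r
    · obtain ⟨Y, hY⟩ := exists_ray_solution hΓ.continuous (hsmall x hx)
      exact ⟨Y, fun _ ↦ hY⟩
    · exact ⟨0, fun h ↦ absurd h hx⟩
  choose Y hY using hex
  refine ⟨r, hr, fun x ↦ Y x 1, ?_, fun x hx ↦ ?_⟩
  · obtain ⟨h0, h1⟩ := hY 0 (by simpa using hr)
    rw [← h0]
    refine constant_of_derivWithin_zero (a := 0) (b := 1)
      (fun t ht ↦ (h1 t ht).differentiableWithinAt) (fun t ht ↦ ?_) 1 (by simp)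
    rw [(h1 t ⟨ht.1, ht.2.le⟩).derivWithin (uniqueDiffOn_Icc zero_lt_one t ⟨ht.1, ht.2.le⟩)]
    simp
  · obtain ⟨hx0, hx1⟩ := hY x hx
    obtain ⟨M, hM⟩ := isCompact_Icc.exists_bound_of_continuousOn
      (fun t ht ↦ (hx1 t ht).continuousWithinAt : ContinuousOn (Y x) (Icc 0 1))
    have hxn : ‖x‖ < r := by simpa using hx
    have hO : (fun y ↦ Y y 1 - Y x 1 - Y x 1 * Γ x (y - x)) =O[𝓝 x] fun y ↦ ‖y - x‖ ^ 2 := by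
      refine Asymptotics.IsBigO.of_bound (M * (3 * C + 5 * C ^ 2) * (Real.exp 1 - 1)) ?_
      filter_upwards [Metric.isOpen_ball.mem_nhds hx] with y hy
      have hyn : ‖y‖ < r := by simpa using hy
      obtain ⟨hy0, hy1⟩ := hY y hy
      rw [norm_pow, norm_norm]
      refine ray_solution_sub_le hΓ hC0 (by linarith)
        ((norm_sub_le _ _).trans (by linarith))
        (fun t ht ↦ hflat _ (by simpa using (hmem x hx t ht).trans_le hrR))
        (fun t ht ↦ ?_) (fun t ht ↦ ?_) hx0 hx1 hy0 hy1 hM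
      · obtain ⟨h1, h2, h3⟩ := hC _ (hmem1 x hx t ht)
        exact ⟨h1, h2, h3 _ (hmem1 y hy t ht)⟩
      · nlinarith [hsmall y hy t ht, norm_nonneg (1 : A), norm_nonneg (Γ (t • y) y)]
    have h2 := (hO.hasFDerivAt (𝕜 := ℝ) (by norm_num)).add
      (((ContinuousLinearMap.mul ℝ A (Y x 1) ∘L Γ x).hasFDerivAt.comp x
        ((hasFDerivAt_id x).sub_const x)).add_const (Y x 1))
    refine (h2.congr_of_eventuallyEq (Filter.Eventually.of_forall fun y ↦ ?_)).congr_fderiv ?_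
    · simp only [Pi.add_apply, Function.comp_apply, id, ContinuousLinearMap.comp_apply,
        ContinuousLinearMap.mul_apply']
      abel
    · ext v; simp

end

/-! ### Hessian charts for a symmetric operator field on a Euclidean space -/

section

open scoped RealInnerProductSpace

variable {E : Type} [NormedAddCommGroup E] [InnerProductSpace ℝ E]

/-- `Q` is the inverse of the compression `π S π` of the symmetric operator `S` to the range of the
orthogonal projection `π`, extended by zero, and `S` is determined by this compression
(`S Q S = S`). Then `S Q` is the projection onto the range of `S` along the kernel of `π`. -/
structure IsCompressedInverse (π S Q : E →L[ℝ] E) : Prop where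
  proj : ∀ a, π (π a) = π a
  proj_symm : ∀ a b, ⟪π a, b⟫ = ⟪a, π b⟫
  symm : ∀ a b, ⟪S a, b⟫ = ⟪a, S b⟫
  left : ∀ a, π (Q a) = Q a
  right : ∀ a, Q (π a) = Q a
  comp : ∀ a, π (S (Q a)) = π a
  full : ∀ a, S (Q (S a)) = S a

namespace IsCompressedInverse

variable {π S Q : E →L[ℝ] E}

theorem inv_symm (h : IsCompressedInverse π S Q) (a b : E) : ⟪Q a, b⟫ = ⟪a, Q b⟫ := by
  have key : ∀ a b, ⟪Q a, b⟫ = ⟪S (Q a), Q b⟫ := fun a b ↦ by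
    rw [← h.left a, h.proj_symm, ← h.comp b, ← h.proj_symm, h.left, h.symm]
  rw [key, real_inner_comm, ← h.symm, ← key, real_inner_comm]

theorem inv_comp (h : IsCompressedInverse π S Q) (a : E) : Q (S (π a)) = π a := by
  refine ext_inner_right ℝ fun b ↦ ?_
  rw [h.inv_symm, h.symm, h.proj_symm, h.comp, ← h.proj_symm]

end IsCompressedInverse

/-- If `S` satisfies the Codazzi equation, then the field `S Q` of projections onto the ranges of
`S` is constant along these ranges. In particular the leaves of the distribution `range S` are open
subsets of affine subspaces. The proof also gives the derivative of `Q`. -/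
theorem fderiv_mul_apply_eq_zero {π : E →L[ℝ] E} {S Q : E → E →L[ℝ] E} {O : Set E}
    (hO : IsOpen O) (hS : ContDiffOn ℝ ∞ S O) (hQ : ContDiffOn ℝ ∞ Q O)
    (h : ∀ z ∈ O, IsCompressedInverse π (S z) (Q z))
    (hcod : ∀ z ∈ O, ∀ a b, fderiv ℝ S z (S z a) b = fderiv ℝ S z (S z b) a)
    {z : E} (hz : z ∈ O) :
    (∀ u, fderiv ℝ Q z u = - (Q z * fderiv ℝ S z u * Q z)) ∧
    ∀ a, fderiv ℝ (fun z ↦ S z * Q z) z (S z (Q z a)) = 0 := by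
  have hnhds := hO.mem_nhds hz
  have hSd : HasFDerivAt S (fderiv ℝ S z) z :=
    ((hS.contDiffAt hnhds).differentiableAt (by simp)).hasFDerivAt
  have hQd : HasFDerivAt Q (fderiv ℝ Q z) z :=
    ((hQ.contDiffAt hnhds).differentiableAt (by simp)).hasFDerivAt
  have hSQ : HasFDerivAt (fun z ↦ S z * Q z) _ z := hSd.mul' hQd
  have hz' := h z hz
  have hDS : ∀ u a b, ⟪fderiv ℝ S z u a, b⟫ = ⟪a, fderiv ℝ S z u b⟫ := by
    intro u a b
    have h1 : HasFDerivAt (fun z ↦ ⟪S z a, b⟫) _ z :=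
      (hSd.clm_apply (hasFDerivAt_const a z)).inner ℝ (hasFDerivAt_const b z)
    have h2 : HasFDerivAt (fun z ↦ ⟪a, S z b⟫) _ z :=
      (hasFDerivAt_const a z).inner ℝ (hSd.clm_apply (hasFDerivAt_const b z))
    have h3 : (fun z ↦ ⟪S z a, b⟫) =ᶠ[𝓝 z] fun z ↦ ⟪a, S z b⟫ := by
      filter_upwards [hnhds] with y hy using (h y hy).symm a b
    have h4 := congrArg (fun T : E →L[ℝ] ℝ ↦ T u) ((h1.congr_of_eventuallyEq h3.symm).unique h2)
    simpa [fderivInnerCLM_apply] using h4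
  -- differentiate `π Q = Q` and `π S Q = π`, and use `Q S π = π`
  have hDQ : ∀ u, fderiv ℝ Q z u = - (Q z * fderiv ℝ S z u * Q z) := by
    intro u
    have h1 : HasFDerivAt (fun z ↦ π * Q z) _ z := hQd.const_mul π
    have h1' : (fun z ↦ π * Q z) =ᶠ[𝓝 z] Q := by
      filter_upwards [hnhds] with y hy
      ext a
      exact (h y hy).left a
    have h2 := congrArg (fun T : E →L[ℝ] E →L[ℝ] E ↦ T u)
      ((h1.congr_of_eventuallyEq h1'.symm).unique hQd)
    have h3 : HasFDerivAt (fun z ↦ π * (S z * Q z)) _ z := hSQ.const_mul π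
    have h3' : (fun z ↦ π * (S z * Q z)) =ᶠ[𝓝 z] fun _ ↦ π := by
      filter_upwards [hnhds] with y hy
      ext a
      exact (h y hy).comp a
    have h4 := congrArg (fun T : E →L[ℝ] E →L[ℝ] E ↦ T u)
      ((h3.congr_of_eventuallyEq h3'.symm).unique (hasFDerivAt_const π z))
    ext a
    have h2a : π (fderiv ℝ Q z u a) = fderiv ℝ Q z u a :=
      congrArg (fun T : E →L[ℝ] E ↦ T a) h2
    have h4a : π (S z (fderiv ℝ Q z u a) + fderiv ℝ S z u (Q z a)) = 0 :=
      congrArg (fun T : E →L[ℝ] E ↦ T a) h4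
    have h5 := congrArg (Q z) h4a
    rw [hz'.right, map_add, map_zero, ← h2a, hz'.inv_comp, h2a] at h5
    exact eq_neg_of_add_eq_zero_left h5
  refine ⟨hDQ, fun a ↦ ?_⟩
  rw [hSQ.fderiv]
  ext b
  change S z (fderiv ℝ Q z (S z (Q z a)) b) + fderiv ℝ S z (S z (Q z a)) (Q z b) = 0
  rw [hDQ]
  refine ext_inner_left ℝ fun d ↦ ?_
  set T := fderiv ℝ S z (S z (Q z a))
  change ⟪d, S z (- Q z (T (Q z b))) + T (Q z b)⟫ = ⟪d, 0⟫
  rw [inner_zero_right, map_neg, inner_add_right, inner_neg_right, ← hz'.symm, ← hz'.inv_symm,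
    neg_add_eq_sub, ← inner_sub_left, ← hDS, hcod z hz]
  simp [map_sub, hz'.full]

variable [FiniteDimensional ℝ E]

/-- The compressed inverse of `S` if `π S π` is invertible on the range of `π` and `S` has the rank
of `π`. The equality of the ranks gives `S Q S = S`. -/
theorem isCompressedInverse_of_isUnit {π S : E →L[ℝ] E} (hπ : ∀ a, π (π a) = π a)
    (hπs : ∀ a b, ⟪π a, b⟫ = ⟪a, π b⟫) (hS : ∀ a b, ⟪S a, b⟫ = ⟪a, S b⟫)
    (hr : Module.finrank ℝ (LinearMap.range S.toLinearMap) =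
      Module.finrank ℝ (LinearMap.range π.toLinearMap))
    (hu : IsUnit (π * S * π + (1 - π))) :
    IsCompressedInverse π S (π * Ring.inverse (π * S * π + (1 - π)) * π) := by
  set B := π * S * π + (1 - π) with hB
  set b := Ring.inverse B
  have hππ : π * π = π := ContinuousLinearMap.ext hπ
  have hBb : B * b = 1 := Ring.mul_inverse_cancel B hu
  have hbB : b * B = 1 := Ring.inverse_mul_cancel B hu
  have hπB : π * B = B * π := by
    simp only [hB, mul_add, add_mul, mul_sub, sub_mul, ← mul_assoc, hππ, one_mul, mul_one]
    simp only [mul_assoc, hππ]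
  have hπb : π * b = b * π := by
    calc π * b = b * B * π * b := by rw [hbB, one_mul]
      _ = b * (π * B) * b := by rw [hπB]; simp only [mul_assoc]
      _ = b * π := by rw [mul_assoc, mul_assoc, hBb, mul_one]
  have hcomp : π * (S * (π * b * π)) = π := by
    calc π * (S * (π * b * π)) = π * B * b * π := by
          simp only [hB, mul_add, mul_sub, ← mul_assoc, hππ, mul_one, sub_self, add_zero]
      _ = π := by rw [mul_assoc π, hBb, mul_one, hππ]
  have hc : ∀ a, π (S ((π * b * π) a)) = π a := fun a ↦ congrArg (fun T : E →L[ℝ] E ↦ T a) hcomp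
  have hQl : ∀ a, π ((π * b * π) a) = (π * b * π) a := fun a ↦ hπ _
  have hQr : ∀ a, (π * b * π) (π a) = (π * b * π) a := fun a ↦ by
    change π (b (π (π a))) = π (b (π a))
    rw [hπ]
  -- the range of `S Q` is contained in that of `S` and has the same dimension
  have hrange : LinearMap.range (S * (π * b * π)).toLinearMap = LinearMap.range S.toLinearMap := by
    refine Submodule.eq_of_le_of_finrank_le ?_ ?_
    · rintro _ ⟨a, rfl⟩
      exact ⟨_, rfl⟩
    · rw [hr]
      have h1 : LinearMap.range π.toLinearMap =
          (LinearMap.range (S * (π * b * π)).toLinearMap).map π.toLinearMap := by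
        rw [← LinearMap.range_comp]
        congr 1
        ext a
        exact (hc a).symm
      rw [h1]
      exact Submodule.finrank_map_le _ _
  refine ⟨hπ, hπs, hS, hQl, hQr, hc, fun a ↦ ?_⟩
  obtain ⟨c, hc'⟩ : S a ∈ LinearMap.range (S * (π * b * π)).toLinearMap := by
    rw [hrange]; exact ⟨a, rfl⟩
  have hc'' : S ((π * b * π) c) = S a := hc'
  rw [← hc'', ← hQr (S _), hc, hQr]

/-- A smooth field of symmetric operators of constant rank has a smooth field of compressed
inverses near a point where its range is that of the projection. -/
theorem exists_isCompressedInverse {π : E →L[ℝ] E} (hπ : ∀ a, π (π a) = π a)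
    (hπs : ∀ a b, ⟪π a, b⟫ = ⟪a, π b⟫) {S : E → E →L[ℝ] E} {O : Set E} (hO : IsOpen O)
    (h0 : 0 ∈ O) (hS : ContDiffOn ℝ ∞ S O) (hsymm : ∀ z ∈ O, ∀ a b, ⟪S z a, b⟫ = ⟪a, S z b⟫)
    (hr : ∀ z ∈ O, Module.finrank ℝ (LinearMap.range (S z).toLinearMap) =
      Module.finrank ℝ (LinearMap.range π.toLinearMap))
    (h0r : LinearMap.range (S 0).toLinearMap = LinearMap.range π.toLinearMap) :
    ∃ Q : E → E →L[ℝ] E, ∃ R > 0, Metric.ball 0 R ⊆ O ∧ ContDiffOn ℝ ∞ Q (Metric.ball 0 R) ∧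
      (∀ z ∈ Metric.ball 0 R, IsCompressedInverse π (S z) (Q z)) ∧ ∀ a, S 0 (Q 0 a) = π a := by
  let B : E → E →L[ℝ] E := fun z ↦ π * S z * π + (1 - π)
  have hB : ContDiffOn ℝ ∞ B O :=
    (((contDiffOn_const (c := π)).clm_comp hS).clm_comp contDiffOn_const).add contDiffOn_const
  have hπS : ∀ a, π (S 0 a) = S 0 a := fun a ↦ by
    obtain ⟨c, hc⟩ : S 0 a ∈ LinearMap.range π.toLinearMap := by rw [← h0r]; exact ⟨a, rfl⟩
    have hc' : π c = S 0 a := hc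
    rw [← hc', hπ]
  have hu0 : IsUnit (B 0) := by
    have hinj : Function.Injective (B 0) := by
      refine (injective_iff_map_eq_zero _).2 fun a ha ↦ ?_
      have ha' : π (S 0 (π a)) + (a - π a) = 0 := ha
      have h1 : a = π a := by
        have := congrArg π ha'
        rw [map_add, hπ, map_sub, hπ, sub_self, add_zero, map_zero] at this
        rw [this, zero_add, sub_eq_zero] at ha'
        exact ha'
      have h2 : S 0 a = 0 := by
        rw [← h1, sub_self, add_zero, hπS] at ha'
        exact ha'
      obtain ⟨c, hc⟩ : π a ∈ LinearMap.range (S 0).toLinearMap := by rw [h0r]; exact ⟨a, rfl⟩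
      have hc' : S 0 c = a := hc.trans h1.symm
      have h3 : ⟪a, a⟫ = 0 := by
        nth_rw 1 [← hc']
        rw [hsymm 0 h0, h2, inner_zero_right]
      exact inner_self_eq_zero.1 h3
    let e := ContinuousLinearEquiv.ofBijective (B 0) (LinearMap.ker_eq_bot.2 hinj)
      (LinearMap.range_eq_top.2 (LinearMap.injective_iff_surjective.1 hinj))
    refine ⟨⟨B 0, e.symm, ?_, ?_⟩, rfl⟩
    · ext a; exact e.apply_symm_apply a
    · ext a; exact e.symm_apply_apply a
  have hopen : IsOpen (O ∩ B ⁻¹' {T | IsUnit T}) :=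
    hB.continuousOn.isOpen_inter_preimage hO Units.isOpen
  obtain ⟨R, hR, hball⟩ := Metric.isOpen_iff.1 hopen 0 ⟨h0, hu0⟩
  have hc : ∀ z ∈ Metric.ball (0 : E) R,
      IsCompressedInverse π (S z) (π * Ring.inverse (B z) * π) := fun z hz ↦
    isCompressedInverse_of_isUnit hπ hπs (hsymm z (hball hz).1) (hr z (hball hz).1)
      (hball hz).2
  refine ⟨fun z ↦ π * Ring.inverse (B z) * π, R, hR, fun z hz ↦ (hball hz).1, fun z hz ↦ ?_, hc,
    fun a ↦ ?_⟩
  · obtain ⟨U, hU⟩ := (hball hz).2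
    have h1 : ContDiffAt ℝ ∞ Ring.inverse (B z) := hU ▸ contDiffAt_ringInverse ℝ U
    have h2 : ContDiffAt ℝ ∞ (fun z ↦ Ring.inverse (B z)) z :=
      h1.comp z (hB.contDiffAt (hO.mem_nhds (hball hz).1))
    exact (((contDiffAt_const (c := π)).clm_comp h2).clm_comp contDiffAt_const).contDiffWithinAt
  · have := (hc 0 (by simpa using hR)).comp a
    rwa [hπS] at this

/-- The flat case. Given a constant rank solution `S` of the Codazzi equation in affine
coordinates, the chart `ψ` straightens the (affine) leaves tangent to the ranges of `S`, and in
this chart the inverse of the compression of `S` is a partial Hessian. -/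
theorem exists_hessian_chart_of_codazzi {π : E →L[ℝ] E} (hπ : ∀ a, π (π a) = π a)
    (hπs : ∀ a b, ⟪π a, b⟫ = ⟪a, π b⟫) {S : E → E →L[ℝ] E} {O : Set E} (hO : IsOpen O)
    (h0 : 0 ∈ O) (hS : ContDiffOn ℝ ∞ S O) (hsymm : ∀ z ∈ O, ∀ a b, ⟪S z a, b⟫ = ⟪a, S z b⟫)
    (hr : ∀ z ∈ O, Module.finrank ℝ (LinearMap.range (S z).toLinearMap) =
      Module.finrank ℝ (LinearMap.range π.toLinearMap))
    (h0r : LinearMap.range (S 0).toLinearMap = LinearMap.range π.toLinearMap)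
    (hcod : ∀ z ∈ O, ∀ a b, fderiv ℝ S z (S z a) b = fderiv ℝ S z (S z b) a) :
    ∃ (ψ : OpenPartialHomeomorph E E) (f : E → ℝ) (Q : E → E →L[ℝ] E),
      0 ∈ ψ.source ∧ ψ.source ⊆ O ∧ ContDiffOn ℝ ∞ ψ ψ.source ∧
      ContDiffOn ℝ ∞ ψ.symm ψ.target ∧ ContDiff ℝ ∞ f ∧ ContDiffOn ℝ ∞ Q ψ.source ∧
      ∀ z ∈ ψ.source, IsCompressedInverse π (S z) (Q z) ∧
        (∀ a, fderiv ℝ (fun z ↦ S z * Q z) z (S z (Q z a)) = 0) ∧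
        (∀ a, fderiv ℝ ψ z (S z (Q z a)) = π a) ∧
        ∀ a b, fderiv ℝ (fun w ↦ fderiv ℝ f w (π b)) (ψ z) (π a) = ⟪Q z a, b⟫ := by
  obtain ⟨Q, R, hR, hRO, hQ, hc, hX0⟩ :=
    exists_isCompressedInverse hπ hπs hO h0 hS hsymm hr h0r
  replace hS := hS.mono hRO
  have hcod' := fun z hz ↦ hcod z (hRO hz)
  have hpar := fun z hz ↦
    fderiv_mul_apply_eq_zero (z := z) Metric.isOpen_ball hS hQ hc hcod' hz
  let X : E → E →L[ℝ] E := fun z ↦ S z * Q z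
  have hX : ContDiffOn ℝ ∞ X (Metric.ball 0 R) := hS.clm_comp hQ
  have hXπ : ∀ z ∈ Metric.ball (0 : E) R, ∀ a, X z (π a) = X z a := fun z hz a ↦
    congrArg (S z) ((hc z hz).right a)
  -- `w - π w` selects a leaf, and `X (w - π w) w` is a vector tangent to it; the chart is the
  -- inverse of `Ψ`
  let Ψ : E → E := fun w ↦ (w - π w) + X (w - π w) w
  -- the domain of `Ψ`
  let O₁ : Set E := {w | w - π w ∈ Metric.ball (0 : E) R}
  have hO₁ : IsOpen O₁ := Metric.isOpen_ball.preimage (by fun_prop)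
  have hXc : ContDiffOn ℝ ∞ (fun w ↦ X (w - π w)) O₁ :=
    hX.comp (t := Metric.ball 0 R) (by fun_prop) fun w hw ↦ hw
  let O₂ : Set E := O₁ ∩ (fun w ↦ ‖w - π w‖ + ‖X (w - π w) w‖) ⁻¹' Iio R
  have hO₂ : IsOpen O₂ := by
    refine ContinuousOn.isOpen_inter_preimage ?_ hO₁ isOpen_Iio
    exact (by fun_prop : Continuous fun w : E ↦ ‖w - π w‖).continuousOn.add
      (hXc.continuousOn.clm_apply continuousOn_id).norm
  have h0O₂ : (0 : E) ∈ O₂ := by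
    simp [O₂, O₁, hR]
  have hΨ : ContDiffOn ℝ ∞ Ψ O₂ :=
    (by fun_prop : ContDiff ℝ ∞ fun w : E ↦ w - π w).contDiffOn.add
      ((hXc.mono inter_subset_left).clm_apply contDiffOn_id)
  have hseg : ∀ w ∈ O₂, ∀ t ∈ Icc (0 : ℝ) 1,
      (w - π w) + t • X (w - π w) w ∈ Metric.ball (0 : E) R := by
    intro w hw t ht
    rw [mem_ball_zero_iff]
    refine (norm_add_le _ _).trans_lt (lt_of_le_of_lt ?_ hw.2)
    change _ ≤ ‖w - π w‖ + ‖X (w - π w) w‖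
    gcongr
    rw [norm_smul, Real.norm_of_nonneg ht.1]
    exact mul_le_of_le_one_left (norm_nonneg _) ht.2
  have hΨR : ∀ w ∈ O₂, Ψ w ∈ Metric.ball (0 : E) R := fun w hw ↦ by
    simpa [Ψ] using hseg w hw 1 (by simp)
  have hXΨ : ∀ w ∈ O₂, X (Ψ w) = X (w - π w) := fun w hw ↦
    eq_of_forall_fderiv_apply_self_eq_zero Metric.isOpen_ball hX (hseg w hw)
      fun z hz ↦ (hpar z hz).2 w
  have hΨd : ∀ w ∈ O₂, HasFDerivAt Ψ ((ContinuousLinearMap.id ℝ E - π) + (X (w - π w) +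
      ((fderiv ℝ X (w - π w)) ∘L (ContinuousLinearMap.id ℝ E - π)).flip w)) w := by
    intro w hw
    have h1 : HasFDerivAt (fun w : E ↦ w - π w) (ContinuousLinearMap.id ℝ E - π) w :=
      (hasFDerivAt_id w).sub π.hasFDerivAt
    have h2 : HasFDerivAt X (fderiv ℝ X (w - π w)) (w - π w) :=
      ((hX.contDiffAt (Metric.isOpen_ball.mem_nhds hw.1)).differentiableAt (by simp)).hasFDerivAt
    have h3 := h1.add ((h2.comp w h1).clm_apply (hasFDerivAt_id w))
    exact h3
  have hΨπ : ∀ w ∈ O₂, ∀ a, fderiv ℝ Ψ w (π a) = X (Ψ w) a := by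
    intro w hw a
    rw [(hΨd w hw).fderiv, hXΨ w hw, ← hXπ _ hw.1 a]
    simp [hπ]
  have hΨ0 : HasFDerivAt Ψ ((ContinuousLinearEquiv.refl ℝ E : E ≃L[ℝ] E) : E →L[ℝ] E) 0 := by
    refine (hΨd 0 h0O₂).congr_fderiv ?_
    ext a
    simp [X, hX0]
  obtain ⟨ψ₀, h0ψ, hψO, hψΨ, hψs, -⟩ := exists_openPartialHomeomorph_eq hO₂ hΨ h0O₂ hΨ0
  obtain ⟨ρ, hρ, hρψ⟩ := Metric.isOpen_iff.1 ψ₀.open_source 0 h0ψ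
  have hρO : ∀ w ∈ Metric.ball (0 : E) ρ, w ∈ O₂ := fun w hw ↦ hψO (hρψ hw)
  -- the Codazzi equation says that `Q ∘ Ψ` is closed along the leaves; as it is symmetric, its
  -- primitive `g` is closed along the leaves too, and has a primitive `f`
  obtain ⟨θ, hθ, hθeq⟩ := exists_contDiff_eqOn_ball hρ
    (hQ.comp (hΨ.mono hρO) fun w hw ↦ hΨR w (hρO w hw))
  have hρ2 : Metric.ball (0 : E) (ρ / 2) ⊆ Metric.ball (0 : E) ρ :=
    Metric.ball_subset_ball (by linarith)
  have hstar : ∀ w ∈ Metric.ball (0 : E) (ρ / 2), ∀ t ∈ Icc (0 : ℝ) 1,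
      w - π w + t • π w ∈ Metric.ball (0 : E) (ρ / 2) := by
    intro w hw t ht
    have h1 : ‖w - π w‖ ≤ ‖w‖ := by
      have h2 : ⟪π w, w - π w⟫ = 0 := by rw [hπs, map_sub, hπ, sub_self, inner_zero_right]
      have h3 := norm_add_sq_eq_norm_sq_add_norm_sq_real h2
      rw [add_sub_cancel] at h3
      nlinarith [norm_nonneg w, norm_nonneg (w - π w), mul_self_nonneg ‖π w‖]
    have h2 : w - π w + t • π w = (1 - t) • (w - π w) + t • w := by module
    rw [h2]
    refine convex_ball (0 : E) (ρ / 2) ?_ hw (by linarith [ht.2]) ht.1 (by ring)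
    rw [mem_ball_zero_iff] at hw ⊢
    exact h1.trans_lt hw
  have hθd : ∀ w ∈ Metric.ball (0 : E) (ρ / 2), ∀ a b,
      fderiv ℝ θ w (π a) b = - Q (Ψ w) (fderiv ℝ S (Ψ w) (S (Ψ w) (Q (Ψ w) a)) (Q (Ψ w) b)) := by
    intro w hw a b
    have hw2 := hρO w (hρ2 hw)
    have h1 : θ =ᶠ[𝓝 w] Q ∘ Ψ := by
      filter_upwards [Metric.isOpen_ball.mem_nhds hw] with y hy using hθeq hy
    have h2 : HasFDerivAt Q (fderiv ℝ Q (Ψ w)) (Ψ w) :=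
      ((hQ.contDiffAt (Metric.isOpen_ball.mem_nhds (hΨR w hw2))).differentiableAt
        (by simp)).hasFDerivAt
    have h3 := h2.comp w (hΨd w hw2).differentiableAt.hasFDerivAt
    rw [h1.fderiv_eq, h3.fderiv, ContinuousLinearMap.comp_apply, hΨπ w hw2,
      (hpar _ (hΨR w hw2)).1]
    rfl
  obtain ⟨g, hg, hgθ⟩ := exists_partial_primitive hπ hθ hstar fun w hw a b ↦ by
    have hw2 := hρO w (hρ2 hw)
    rw [hθd w hw, hθd w hw, (hc _ (hΨR w hw2)).right, (hc _ (hΨR w hw2)).right,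
      hcod' _ (hΨR w hw2)]
  have hgin : ∀ w ∈ Metric.ball (0 : E) (ρ / 2), ∀ a b,
      ⟪fderiv ℝ g w (π a), b⟫ = ⟪Q (Ψ w) a, b⟫ := by
    intro w hw a b
    rw [hgθ w hw, hθeq hw, Function.comp_apply, (hc _ (hΨR w (hρO w (hρ2 hw)))).right]
  have hgd : ∀ w, HasFDerivAt g (fderiv ℝ g w) w := fun w ↦
    (hg.differentiable (by simp) w).hasFDerivAt
  have hθ2 : ContDiff ℝ ∞ fun w ↦ innerSL ℝ (g w) :=
    (innerSL ℝ (E := E)).contDiff.comp hg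
  obtain ⟨f, hf, hfg⟩ := exists_partial_primitive hπ hθ2 hstar fun w hw a b ↦ by
    have h1 : HasFDerivAt (fun w ↦ innerSL ℝ (g w)) _ w :=
      (innerSL ℝ (E := E)).hasFDerivAt.comp w (hgd w)
    rw [h1.fderiv]
    change ⟪fderiv ℝ g w (π a), π b⟫ = ⟪fderiv ℝ g w (π b), π a⟫
    have hw2 := hc _ (hΨR w (hρO w (hρ2 hw)))
    rw [hgin w hw, hgin w hw, hw2.inv_symm, hw2.right, real_inner_comm, ← hw2.right b,
      hw2.inv_symm, hw2.inv_symm, hw2.right, ← hw2.inv_symm, hw2.right, ← hw2.left, hπs,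
      hw2.inv_symm, hw2.right]
  let χ := ψ₀.restrOpen _ (Metric.isOpen_ball (x := (0 : E)) (ε := ρ / 2))
  have hχΨ : ⇑χ = Ψ := hψΨ
  have hχs : χ.source ⊆ Metric.ball (0 : E) (ρ / 2) := fun w hw ↦ hw.2
  have hχt : χ.target ⊆ ψ₀.target := fun z hz ↦ by
    have h1 := ψ₀.map_source (χ.map_target hz).1
    have h2 : ψ₀ (χ.symm z) = z := χ.right_inv hz
    rwa [h2] at h1
  have hχsm : ContDiffOn ℝ ∞ χ.symm χ.target := hψs.mono hχt
  have hex : ∀ z ∈ χ.target, ∃ w ∈ Metric.ball (0 : E) (ρ / 2), χ.symm z = w ∧ Ψ w = z :=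
    fun z hz ↦ ⟨χ.symm z, hχs (χ.map_target hz), rfl, hχΨ ▸ χ.right_inv hz⟩
  have hsub : χ.target ⊆ Metric.ball 0 R := fun z hz ↦ by
    obtain ⟨w, hw, -, rfl⟩ := hex z hz
    exact hΨR w (hρO w (hρ2 hw))
  refine ⟨χ.symm, f, Q, ?_, fun z hz ↦ hRO (hsub hz), hχsm, ?_, hf, hQ.mono hsub,
    fun z hz ↦ ⟨hc z (hsub hz), (hpar z (hsub hz)).2, fun a ↦ ?_, fun a b ↦ ?_⟩⟩
  · have h1 : (0 : E) ∈ χ.source := ⟨h0ψ, by simpa using hρ⟩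
    have h2 := χ.map_source h1
    rw [hχΨ] at h2
    simpa [Ψ] using h2
  · change ContDiffOn ℝ ∞ χ χ.source
    rw [hχΨ]
    exact hΨ.mono fun w hw ↦ hρO w (hρ2 (hχs hw))
  · obtain ⟨w, hw, hzw, rfl⟩ := hex z hz
    have hwχ : w ∈ χ.source := hzw ▸ χ.map_target hz
    have h1 : HasFDerivAt χ.symm (fderiv ℝ χ.symm (Ψ w)) (Ψ w) :=
      ((hχsm.contDiffAt (χ.open_target.mem_nhds hz)).differentiableAt (by simp)).hasFDerivAt
    have h2 := h1.comp w (hΨd w (hρO w (hρ2 hw))).differentiableAt.hasFDerivAt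
    have h3 : χ.symm ∘ Ψ =ᶠ[𝓝 w] id := by
      filter_upwards [χ.open_source.mem_nhds hwχ] with y hy
      rw [← hχΨ]
      exact χ.left_inv hy
    have h4 := h2.unique ((hasFDerivAt_id w).congr_of_eventuallyEq h3)
    have h5 := congrArg (fun T : E →L[ℝ] E ↦ T (π a)) h4
    change fderiv ℝ χ.symm (Ψ w) (fderiv ℝ Ψ w (π a)) = π a at h5
    rwa [hΨπ w (hρO w (hρ2 hw))] at h5
  · obtain ⟨w, hw, hzw, rfl⟩ := hex z hz
    rw [hzw]
    have h1 : (fun w ↦ fderiv ℝ f w (π b)) =ᶠ[𝓝 w] fun w ↦ ⟪g w, π b⟫ := by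
      filter_upwards [Metric.isOpen_ball.mem_nhds hw] with y hy using hfg y hy b
    have h2 : HasFDerivAt (fun w ↦ ⟪g w, π b⟫) _ w :=
      (hgd w).inner ℝ (hasFDerivAt_const (π b) w)
    have hw2 := hc _ (hΨR w (hρO w (hρ2 hw)))
    rw [h1.fderiv_eq, h2.fderiv]
    simp only [ContinuousLinearMap.comp_apply, ContinuousLinearMap.prod_apply,
      fderivInnerCLM_apply, _root_.zero_apply, inner_zero_right, zero_add]
    rw [hgin w hw, hw2.inv_symm, hw2.right, hw2.inv_symm]

end

/-! ### Local coordinates adapted to a flat torsion-free connection -/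

section

open scoped RealInnerProductSpace

theorem exists_equiv_map_eq {E : Type*} [NormedAddCommGroup E] [NormedSpace ℝ E]
    [FiniteDimensional ℝ E] {U V : Submodule ℝ E}
    (h : Module.finrank ℝ U = Module.finrank ℝ V) : ∃ P : E ≃L[ℝ] E, U.map P.toLinearMap = V := by
  obtain ⟨U', hU⟩ := U.exists_isCompl
  obtain ⟨V', hV⟩ := V.exists_isCompl
  have h' : Module.finrank ℝ U' = Module.finrank ℝ V' := by
    have h1 := Submodule.finrank_add_eq_of_isCompl hU
    have h2 := Submodule.finrank_add_eq_of_isCompl hV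
    omega
  let e : E ≃ₗ[ℝ] E := (U.prodEquivOfIsCompl U' hU).symm ≪≫ₗ
    ((LinearEquiv.ofFinrankEq U V h).prodCongr (LinearEquiv.ofFinrankEq U' V' h')) ≪≫ₗ
    V.prodEquivOfIsCompl V' hV
  refine ⟨e.toContinuousLinearEquiv, Submodule.eq_of_le_of_finrank_eq ?_ ?_⟩
  · rintro _ ⟨a, ha, rfl⟩
    have h1 : (U.prodEquivOfIsCompl U' hU).symm a = ((⟨a, ha⟩ : U), (0 : U')) :=
      Submodule.prodEquivOfIsCompl_symm_apply_left U U' hU (⟨a, ha⟩ : U)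
    change e a ∈ V
    simp only [e, LinearEquiv.trans_apply, h1]
    simp
  · rw [← h]
    exact LinearEquiv.finrank_map_eq e U

/-- A differentiable solution of the linear equation `dF = F Γ` with smooth `Γ` is smooth. -/
theorem contDiffOn_of_hasFDerivAt_mul {E A : Type*} [NormedAddCommGroup E] [NormedSpace ℝ E]
    [NormedRing A] [NormedAlgebra ℝ A] {Γ : E → E →L[ℝ] A} (hΓ : ContDiff ℝ ∞ Γ) {F : E → A}
    {s : Set E} (hs : IsOpen s)
    (hF : ∀ x ∈ s, HasFDerivAt F (ContinuousLinearMap.mul ℝ A (F x) ∘L Γ x) x) :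
    ContDiffOn ℝ ∞ F s := by
  rw [contDiffOn_infty]
  intro m
  induction m with
  | zero => exact contDiffOn_zero.2 fun x hx ↦ (hF x hx).continuousAt.continuousWithinAt
  | succ m ih =>
    refine (contDiffOn_succ_iff_fderiv_of_isOpen (n := m) hs).2
      ⟨fun x hx ↦ (hF x hx).differentiableAt.differentiableWithinAt, by simp, ?_⟩
    have h1 : ContDiffOn ℝ m (fun x ↦ ContinuousLinearMap.mul ℝ A (F x) ∘L Γ x) s :=
      ((ContinuousLinearMap.mul ℝ A).contDiff.comp_contDiffOn ih).clm_comp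
        (hΓ.of_le (by exact_mod_cast le_top)).contDiffOn
    exact h1.congr fun x hx ↦ (hF x hx).fderiv

variable {E : Type} [NormedAddCommGroup E] [InnerProductSpace ℝ E] [FiniteDimensional ℝ E]

/-- Affine coordinates of a flat torsion-free connection with Christoffel symbols `Γ`: a chart whose
derivative `θ` is parallel and takes a prescribed value at the origin. Flatness gives the parallel
frame `θ`, and vanishing torsion makes it closed. -/
theorem exists_affine_chart {Γ : E → E →L[ℝ] E →L[ℝ] E} {O : Set E} (hO : IsOpen O) (h0 : 0 ∈ O)
    (hΓ : ContDiffOn ℝ ∞ Γ O) (htor : ∀ z ∈ O, ∀ v w, Γ z v w = Γ z w v)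
    (hflat : ∀ z ∈ O, ∀ v w, fderiv ℝ Γ z v w - fderiv ℝ Γ z w v
      + Γ z v * Γ z w - Γ z w * Γ z v = 0) (P : E ≃L[ℝ] E) :
    ∃ (χ : OpenPartialHomeomorph E E) (θ : E → E →L[ℝ] E), 0 ∈ χ.source ∧ χ.source ⊆ O ∧ χ 0 = 0 ∧
      θ 0 = P ∧ ContDiffOn ℝ ∞ χ χ.source ∧ ContDiffOn ℝ ∞ χ.symm χ.target ∧
      ContDiffOn ℝ ∞ θ χ.source ∧ ∀ z ∈ χ.source, HasFDerivAt χ (θ z) z ∧ IsUnit (θ z) ∧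
        HasFDerivAt θ (ContinuousLinearMap.mul ℝ (E →L[ℝ] E) (θ z) ∘L Γ z) z := by
  obtain ⟨R, hR, hRO⟩ := Metric.isOpen_iff.1 hO 0 h0
  obtain ⟨Γ', hΓ', hΓeq⟩ := exists_contDiff_eqOn_ball hR (hΓ.mono hRO)
  have hR2 : Metric.ball (0 : E) (R / 2) ⊆ O :=
    (Metric.ball_subset_ball (by linarith)).trans hRO
  have hflat' : ∀ x ∈ Metric.ball (0 : E) (R / 2), ∀ v w, fderiv ℝ Γ' x v w - fderiv ℝ Γ' x w v
      + Γ' x v * Γ' x w - Γ' x w * Γ' x v = 0 := by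
    intro x hx v w
    have h1 : Γ' =ᶠ[𝓝 x] Γ := by
      filter_upwards [Metric.isOpen_ball.mem_nhds hx] with y hy using hΓeq hy
    rw [h1.fderiv_eq, hΓeq hx]
    exact hflat x (hR2 hx) v w
  obtain ⟨r, hr, F, hF0, hF⟩ := exists_parallel_frame hΓ' (half_pos hR) hflat'
  set ρ := min r (R / 2)
  have hρ : 0 < ρ := by positivity
  have hρr : Metric.ball (0 : E) ρ ⊆ Metric.ball 0 r := Metric.ball_subset_ball (min_le_left _ _)
  have hρR : Metric.ball (0 : E) ρ ⊆ Metric.ball 0 (R / 2) :=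
    Metric.ball_subset_ball (min_le_right _ _)
  have hFs : ContDiffOn ℝ ∞ F (Metric.ball 0 ρ) :=
    contDiffOn_of_hasFDerivAt_mul hΓ' Metric.isOpen_ball fun x hx ↦ hF x (hρr hx)
  let θ : E → E →L[ℝ] E := fun z ↦ (P : E →L[ℝ] E) * F z
  have hθs : ContDiffOn ℝ ∞ θ (Metric.ball 0 ρ) := contDiffOn_const.clm_comp hFs
  have hθ : ∀ z ∈ Metric.ball (0 : E) ρ,
      HasFDerivAt θ (ContinuousLinearMap.mul ℝ (E →L[ℝ] E) (θ z) ∘L Γ z) z := by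
    intro z hz
    refine ((hF z (hρr hz)).const_mul (P : E →L[ℝ] E)).congr_fderiv ?_
    rw [hΓeq (hρR hz)]
    ext v w
    rfl
  obtain ⟨θ', hθ', hθeq⟩ := exists_contDiff_eqOn_ball hρ hθs
  have hρ2 : Metric.ball (0 : E) (ρ / 2) ⊆ Metric.ball 0 ρ :=
    Metric.ball_subset_ball (by linarith)
  have hstar : ∀ w ∈ Metric.ball (0 : E) (ρ / 2), ∀ t ∈ Icc (0 : ℝ) 1,
      w - ContinuousLinearMap.id ℝ E w + t • ContinuousLinearMap.id ℝ E w ∈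
        Metric.ball (0 : E) (ρ / 2) := by
    intro w hw t ht
    simp only [ContinuousLinearMap.id_apply, sub_self, zero_add, mem_ball_zero_iff, norm_smul,
      Real.norm_of_nonneg ht.1] at hw ⊢
    exact (mul_le_of_le_one_left (norm_nonneg _) ht.2).trans_lt hw
  have hclosed : ∀ w ∈ Metric.ball (0 : E) (ρ / 2), ∀ a b,
      fderiv ℝ θ' w (ContinuousLinearMap.id ℝ E a) (ContinuousLinearMap.id ℝ E b) =
        fderiv ℝ θ' w (ContinuousLinearMap.id ℝ E b) (ContinuousLinearMap.id ℝ E a) := by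
    intro w hw a b
    have h1 : θ' =ᶠ[𝓝 w] θ := by
      filter_upwards [Metric.isOpen_ball.mem_nhds hw] with y hy using hθeq hy
    rw [h1.fderiv_eq, (hθ w (hρ2 hw)).fderiv]
    exact congrArg (θ w) (htor w (hR2 (hρR (hρ2 hw))) a b)
  obtain ⟨u, hu, huθ⟩ := exists_partial_primitive (fun _ ↦ rfl) hθ' hstar hclosed
  have hud : ∀ z ∈ Metric.ball (0 : E) (ρ / 2), HasFDerivAt (fun z ↦ u z - u 0) (θ z) z := by
    intro z hz
    refine ((hu.differentiable (by simp) z).hasFDerivAt.sub_const (u 0)).congr_fderiv ?_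
    ext v
    rw [← hθeq hz]
    exact huθ z hz v
  have h0ρ : (0 : E) ∈ Metric.ball (0 : E) (ρ / 2) := by simpa using hρ
  have hθ0 : θ 0 = P := by simp [θ, hF0]
  have hus : ContDiff ℝ ∞ fun z ↦ u z - u 0 := hu.sub contDiff_const
  obtain ⟨χ, h0χ, hχ, hχu, hχs, hinv⟩ := exists_openPartialHomeomorph_eq Metric.isOpen_ball
    hus.contDiffOn h0ρ (F' := P) (hθ0 ▸ hud 0 h0ρ)
  refine ⟨χ, θ, h0χ, fun z hz ↦ hR2 (hρR (hρ2 (hχ hz))), by simp [hχu], hθ0,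
    by rw [hχu]; exact hus.contDiffOn, hχs, hθs.mono fun z hz ↦ hρ2 (hχ hz), fun z hz ↦ ⟨?_, ?_,
    hθ z (hρ2 (hχ hz))⟩⟩
  · rw [hχu]
    exact hud z (hχ hz)
  · obtain ⟨e, he⟩ := hinv z hz
    rw [(hud z (hχ hz)).fderiv] at he
    rw [← he]
    refine ⟨⟨e, e.symm, ?_, ?_⟩, rfl⟩
    · ext a; exact e.apply_symm_apply a
    · ext a; exact e.symm_apply_apply a

/-- The adjoint as a real-linear continuous map. Mathlib's `ContinuousLinearMap.adjoint` is
conjugate-linear, which blocks the calculus lemmas. -/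
noncomputable def adjointCLM (E : Type) [NormedAddCommGroup E] [InnerProductSpace ℝ E]
    [FiniteDimensional ℝ E] : (E →L[ℝ] E) →L[ℝ] (E →L[ℝ] E) :=
  LinearMap.toContinuousLinearMap
    { toFun := fun T ↦ ContinuousLinearMap.adjoint T
      map_add' := fun T U ↦ map_add _ T U
      map_smul' := fun c T ↦ by simp }

theorem inner_adjointCLM (T : E →L[ℝ] E) (a b : E) : ⟪adjointCLM E T a, b⟫ = ⟪a, T b⟫ :=
  ContinuousLinearMap.adjoint_inner_left T b a

theorem inner_adjointCLM_right (T : E →L[ℝ] E) (a b : E) : ⟪a, adjointCLM E T b⟫ = ⟪T a, b⟫ :=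
  ContinuousLinearMap.adjoint_inner_right T a b

theorem adjointCLM_mul (T U : E →L[ℝ] E) :
    adjointCLM E (T * U) = adjointCLM E U * adjointCLM E T :=
  ContinuousLinearMap.adjoint_comp T U

theorem range_conj_adjointCLM {T : E →L[ℝ] E} (hT : IsUnit T) (S : E →L[ℝ] E) :
    LinearMap.range (T * S * adjointCLM E T).toLinearMap =
      (LinearMap.range S.toLinearMap).map T.toLinearMap := by
  obtain ⟨V, hTV, hVT⟩ := isUnit_iff_exists.1 hT
  ext a
  constructor
  · rintro ⟨b, rfl⟩
    exact ⟨S (adjointCLM E T b), ⟨_, rfl⟩, rfl⟩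
  · rintro ⟨_, ⟨b, rfl⟩, rfl⟩
    refine ⟨adjointCLM E V b, ?_⟩
    have h1 : adjointCLM E T * adjointCLM E V = 1 := by
      rw [← adjointCLM_mul, hVT]
      exact ContinuousLinearMap.adjoint_id
    have h2 : adjointCLM E T (adjointCLM E V b) = b :=
      congrArg (fun T : E →L[ℝ] E ↦ T b) h1
    change T (S (adjointCLM E T (adjointCLM E V b))) = T (S b)
    rw [h2]

/-- Pushing a solution `S` of the Codazzi equation of the connection `d + Γ` forward by an affine
chart gives a solution of the Codazzi equation of the trivial connection. -/
theorem codazzi_pushforward {Γ : E →L[ℝ] E →L[ℝ] E} {S S' : E → E →L[ℝ] E}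
    {θ : E → E →L[ℝ] E} {χ : E → E} {z : E} {DS : E →L[ℝ] E →L[ℝ] E}
    (hχ : HasFDerivAt χ (θ z) z)
    (hθ : HasFDerivAt θ (ContinuousLinearMap.mul ℝ (E →L[ℝ] E) (θ z) ∘L Γ) z)
    (hS : HasFDerivAt S DS z) (hS' : DifferentiableAt ℝ S' (χ z))
    (hpush : S' ∘ χ =ᶠ[𝓝 z] fun z ↦ θ z * S z * adjointCLM E (θ z))
    (hsymm : ∀ a b, ⟪S z a, b⟫ = ⟪a, S z b⟫)
    (hcod : ∀ a b c, ⟪DS (S z a) b, c⟫ + ⟪b, Γ (S z a) (S z c)⟫ + ⟪Γ (S z a) (S z b), c⟫ =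
      ⟪DS (S z b) a, c⟫ + ⟪a, Γ (S z b) (S z c)⟫ + ⟪Γ (S z b) (S z a), c⟫) (a b : E) :
    fderiv ℝ S' (χ z) (S' (χ z) a) b = fderiv ℝ S' (χ z) (S' (χ z) b) a := by
  have h1 := (hS'.hasFDerivAt.comp z hχ).congr_of_eventuallyEq hpush.symm
  have h2 : HasFDerivAt (fun z ↦ θ z * S z * adjointCLM E (θ z)) _ z :=
    (hθ.mul' hS).mul' ((adjointCLM E).hasFDerivAt.comp z hθ)
  have h3 := h1.unique h2
  have hval : S' (χ z) = θ z * S z * adjointCLM E (θ z) := hpush.eq_of_nhds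
  have key : ∀ a b c, ⟪fderiv ℝ S' (χ z) (S' (χ z) a) b, c⟫ =
      ⟪DS (S z (adjointCLM E (θ z) a)) (adjointCLM E (θ z) b), adjointCLM E (θ z) c⟫ +
      ⟪adjointCLM E (θ z) b, Γ (S z (adjointCLM E (θ z) a)) (S z (adjointCLM E (θ z) c))⟫ +
      ⟪Γ (S z (adjointCLM E (θ z) a)) (S z (adjointCLM E (θ z) b)), adjointCLM E (θ z) c⟫ := by
    intro a b c
    set v := S z (adjointCLM E (θ z) a)
    have h4 : fderiv ℝ S' (χ z) (S' (χ z) a) b =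
        (θ z) (S z (adjointCLM E (θ z * Γ v) b)) +
        (θ z (DS v (adjointCLM E (θ z) b)) + θ z (Γ v (S z (adjointCLM E (θ z) b)))) := by
      rw [hval]
      exact congrArg (fun T : E →L[ℝ] E →L[ℝ] E ↦ T v b) h3
    rw [h4, inner_add_left, inner_add_left, adjointCLM_mul]
    simp only [inner_adjointCLM_right]
    change ⟪θ z (S z (adjointCLM E (Γ v) (adjointCLM E (θ z) b))), c⟫ + _ = _
    rw [← inner_adjointCLM_right, hsymm, inner_adjointCLM]
    ring
  refine ext_inner_right ℝ fun c ↦ ?_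
  rw [key, key, hcod]

/-- Local form of the theorem, in a chart where the connection is `d + Γ` and the bivector field is
given by the symmetric operators `S`. The vectors `X z a` with `a` in the range of `π` are the
coordinate vectors of the chart `ψ` tangent to the leaves, and the compression of `N z` to the
range of `π` is the matrix of the bivector in this chart. The proof straightens the connection by
`exists_affine_chart` and applies `exists_hessian_chart_of_codazzi`. -/
theorem exists_hessian_chart {Γ : E → E →L[ℝ] E →L[ℝ] E} {S : E → E →L[ℝ] E} {O : Set E}
    (hO : IsOpen O) (h0 : 0 ∈ O)
    (hΓ : ContDiffOn ℝ ∞ Γ O) (htor : ∀ z ∈ O, ∀ v w, Γ z v w = Γ z w v)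
    (hflat : ∀ z ∈ O, ∀ v w, fderiv ℝ Γ z v w - fderiv ℝ Γ z w v
      + Γ z v * Γ z w - Γ z w * Γ z v = 0)
    {π : E →L[ℝ] E} (hπ : ∀ a, π (π a) = π a) (hπs : ∀ a b, ⟪π a, b⟫ = ⟪a, π b⟫)
    (hS : ContDiffOn ℝ ∞ S O) (hsymm : ∀ z ∈ O, ∀ a b, ⟪S z a, b⟫ = ⟪a, S z b⟫)
    (hr : ∀ z ∈ O, Module.finrank ℝ (LinearMap.range (S z).toLinearMap) =
      Module.finrank ℝ (LinearMap.range π.toLinearMap))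
    (hcod : ∀ z ∈ O, ∀ a b c, ⟪fderiv ℝ S z (S z a) b, c⟫ + ⟪b, Γ z (S z a) (S z c)⟫ +
        ⟪Γ z (S z a) (S z b), c⟫ =
      ⟪fderiv ℝ S z (S z b) a, c⟫ + ⟪a, Γ z (S z b) (S z c)⟫ + ⟪Γ z (S z b) (S z a), c⟫) :
    ∃ (ψ : OpenPartialHomeomorph E E) (f : E → ℝ) (X N Q : E → E →L[ℝ] E),
      0 ∈ ψ.source ∧ ψ.source ⊆ O ∧ ContDiffOn ℝ ∞ ψ ψ.source ∧
      ContDiffOn ℝ ∞ ψ.symm ψ.target ∧ ContDiff ℝ ∞ f ∧ ContDiffOn ℝ ∞ X ψ.source ∧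
      ∀ z ∈ ψ.source, IsCompressedInverse π (N z) (Q z) ∧
        (∀ a, X z (π a) = X z a) ∧ S z = X z * N z * adjointCLM E (X z) ∧
        (∀ a b, fderiv ℝ X z (X z a) b + Γ z (X z a) (X z b) = 0) ∧
        (∀ a, fderiv ℝ ψ z (X z a) = π a) ∧
        ∀ a b, fderiv ℝ (fun w ↦ fderiv ℝ f w (π b)) (ψ z) (π a) = ⟪Q z a, b⟫ := by
  obtain ⟨P, hP⟩ := exists_equiv_map_eq (hr 0 h0)
  obtain ⟨χ, θ, h0χ, hχO, hχ0, hθ0, hχs, hχs', hθs, hχθ⟩ :=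
    exists_affine_chart hO h0 hΓ htor hflat P
  let H : E → E →L[ℝ] E := fun z ↦ θ z * S z * adjointCLM E (θ z)
  have hH : ContDiffOn ℝ ∞ H χ.source :=
    (hθs.clm_comp (hS.mono hχO)).clm_comp ((adjointCLM E).contDiff.comp_contDiffOn hθs)
  let S' : E → E →L[ℝ] E := H ∘ χ.symm
  have hS' : ContDiffOn ℝ ∞ S' χ.target := hH.comp hχs' χ.mapsTo_symm
  have hS'χ : ∀ z ∈ χ.source, S' (χ z) = H z := fun z hz ↦ congrArg H (χ.left_inv hz)
  have hforall : ∀ {p : E → Prop}, (∀ z ∈ χ.source, p (χ z)) → ∀ y ∈ χ.target, p y :=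
    fun {p} h y hy ↦ χ.right_inv hy ▸ h _ (χ.map_target hy)
  have h0t : (0 : E) ∈ χ.target := hχ0 ▸ χ.map_source h0χ
  have hHsymm : ∀ z ∈ χ.source, ∀ a b, ⟪H z a, b⟫ = ⟪a, H z b⟫ := by
    intro z hz a b
    change ⟪θ z (S z (adjointCLM E (θ z) a)), b⟫ = ⟪a, θ z (S z (adjointCLM E (θ z) b))⟫
    rw [← inner_adjointCLM_right, hsymm z (hχO hz), inner_adjointCLM]
  have hHr : ∀ z ∈ χ.source, Module.finrank ℝ (LinearMap.range (H z).toLinearMap) =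
      Module.finrank ℝ (LinearMap.range π.toLinearMap) := by
    intro z hz
    rw [range_conj_adjointCLM (hχθ z hz).2.1, ← hr z (hχO hz)]
    obtain ⟨V, -, hV⟩ := isUnit_iff_exists.1 (hχθ z hz).2.1
    have hinj : Function.Injective (θ z).toLinearMap :=
      Function.LeftInverse.injective (g := V) fun a ↦ congrArg (fun T : E →L[ℝ] E ↦ T a) hV
    exact (Submodule.equivMapOfInjective _ hinj _).finrank_eq.symm
  obtain ⟨ψ, f, Q, h0ψ, hψχ, hψs, hψs', hf, hQ, hψ⟩ := exists_hessian_chart_of_codazzi hπ hπs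
    χ.open_target h0t hS'
    (hforall fun z hz ↦ by rw [hS'χ z hz]; exact hHsymm z hz)
    (hforall fun z hz ↦ by rw [hS'χ z hz]; exact hHr z hz)
    (by
      rw [← hχ0, hS'χ 0 h0χ, range_conj_adjointCLM (hχθ 0 h0χ).2.1, hθ0]
      exact hP)
    (hforall fun z hz a b ↦ by
      refine codazzi_pushforward (hχθ z hz).1 (hχθ z hz).2.2
        ((hS.contDiffAt (hO.mem_nhds (hχO hz))).differentiableAt (by simp)).hasFDerivAt
        ((hS'.contDiffAt (χ.open_target.mem_nhds (χ.map_source hz))).differentiableAt (by simp))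
        ?_ (hsymm z (hχO hz)) (hcod z (hχO hz)) a b
      filter_upwards [χ.open_source.mem_nhds hz] with y hy using hS'χ y hy)
  let X : E → E →L[ℝ] E := fun z ↦ Ring.inverse (θ z) * (S' (χ z) * Q (χ z))
  have hsrc : (χ.trans ψ).source ⊆ χ.source := fun z hz ↦ hz.1
  have hmaps : ∀ z ∈ (χ.trans ψ).source, χ z ∈ ψ.source := fun z hz ↦ hz.2
  have hX : ContDiffOn ℝ ∞ X (χ.trans ψ).source := by
    have h1 : ContDiffOn ℝ ∞ (fun z ↦ Ring.inverse (θ z)) χ.source := fun z hz ↦ by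
      obtain ⟨U, hU⟩ := (hχθ z hz).2.1
      have h2 : ContDiffAt ℝ ∞ Ring.inverse (θ z) := hU ▸ contDiffAt_ringInverse ℝ U
      exact h2.comp_contDiffWithinAt z (hθs z hz)
    exact (h1.mono hsrc).clm_comp (((hS'.mono hψχ).clm_comp hQ).comp (hχs.mono hsrc) hmaps)
  have hθX : ∀ z ∈ (χ.trans ψ).source, θ z * X z = S' (χ z) * Q (χ z) := fun z hz ↦ by
    rw [← mul_assoc, Ring.mul_inverse_cancel _ (hχθ z (hsrc hz)).2.1, one_mul]
  refine ⟨χ.trans ψ, f, X, fun z ↦ S' (χ z), fun z ↦ Q (χ z), ⟨h0χ, ?_⟩,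
    fun z hz ↦ hχO (hsrc hz), hψs.comp (hχs.mono hsrc) hmaps,
    hχs'.comp (hψs'.mono fun y hy ↦ hy.1) fun y hy ↦ hy.2, hf, hX, fun z hz ↦ ?_⟩
  · change χ 0 ∈ ψ.source
    rwa [hχ0]
  obtain ⟨hcomp, hpar, hψX, hhess⟩ := hψ _ (hmaps z hz)
  obtain ⟨hχd, hu, hθd⟩ := hχθ z (hsrc hz)
  have hθXa : ∀ a, θ z (X z a) = S' (χ z) (Q (χ z) a) := fun a ↦
    congrArg (fun T : E →L[ℝ] E ↦ T a) (hθX z hz)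
  have hinvθ : ∀ a, (Ring.inverse (θ z) : E →L[ℝ] E) (θ z a) = a := fun a ↦
    congrArg (fun T : E →L[ℝ] E ↦ T a) (Ring.inverse_mul_cancel _ hu)
  refine ⟨hcomp, fun a ↦ ?_, ?_, fun a b ↦ ?_, fun a ↦ ?_, hhess⟩
  · change (Ring.inverse (θ z) : E →L[ℝ] E) (S' (χ z) (Q (χ z) (π a))) = _
    rw [hcomp.right]
    rfl
  · ext a
    set V : E →L[ℝ] E := Ring.inverse (θ z)
    have h1 : adjointCLM E (X z) a = Q (χ z) (S' (χ z) (adjointCLM E V a)) := by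
      refine ext_inner_right ℝ fun c ↦ ?_
      rw [inner_adjointCLM, hcomp.inv_symm, hcomp.symm, inner_adjointCLM]
      rfl
    have h2 : adjointCLM E (θ z) (adjointCLM E V a) = a := by
      have : adjointCLM E (θ z) * adjointCLM E V = 1 := by
        rw [← adjointCLM_mul, Ring.inverse_mul_cancel _ hu]
        exact ContinuousLinearMap.adjoint_id
      exact congrArg (fun T : E →L[ℝ] E ↦ T a) this
    change S z a = V (S' (χ z) (Q (χ z) (S' (χ z) (adjointCLM E (X z) a))))
    rw [h1, hcomp.full, hcomp.full, hS'χ z (hsrc hz)]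
    change S z a = V (θ z (S z (adjointCLM E (θ z) (adjointCLM E V a))))
    rw [h2, hinvθ]
  · have hXd : HasFDerivAt X (fderiv ℝ X z) z :=
      ((hX.contDiffAt ((χ.trans ψ).open_source.mem_nhds hz)).differentiableAt
        (by simp)).hasFDerivAt
    have h1 : HasFDerivAt (fun z ↦ θ z * X z) _ z := hθd.mul' hXd
    have h2 : DifferentiableAt ℝ (fun y ↦ S' y * Q y) (χ z) :=
      (((hS'.mono hψχ).clm_comp hQ).contDiffAt
        (ψ.open_source.mem_nhds (hmaps z hz))).differentiableAt (by simp)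
    have h3 := h2.hasFDerivAt.comp z hχd
    have h4 : (fun z ↦ θ z * X z) =ᶠ[𝓝 z] (fun y ↦ S' y * Q y) ∘ χ := by
      filter_upwards [(χ.trans ψ).open_source.mem_nhds hz] with y hy using hθX y hy
    have h5 := congrArg (fun T : E →L[ℝ] E →L[ℝ] E ↦ T (X z a) b)
      ((h1.congr_of_eventuallyEq h4.symm).unique h3)
    have h6 : θ z (fderiv ℝ X z (X z a) b) + θ z (Γ z (X z a) (X z b)) =
        fderiv ℝ (fun y ↦ S' y * Q y) (χ z) (θ z (X z a)) b := h5
    rw [hθXa, hpar] at h6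
    rw [← map_add] at h6
    have h7 := congrArg (Ring.inverse (θ z) : E →L[ℝ] E) h6
    rw [hinvθ] at h7
    simpa using h7
  · have h1 : HasFDerivAt ψ (fderiv ℝ ψ (χ z)) (χ z) :=
      ((hψs.contDiffAt (ψ.open_source.mem_nhds (hmaps z hz))).differentiableAt
        (by simp)).hasFDerivAt
    have h2 : HasFDerivAt (χ.trans ψ) _ z := h1.comp z hχd
    rw [h2.fderiv, ContinuousLinearMap.comp_apply, hθXa, hψX]

end

/-! ### Charts and the vector fields they induce -/

namespace GPH

open Bundle

variable {n : ℕ} {M : Type*} [TopologicalSpace M] [ChartedSpace (Model n) M]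

/-- The derivative of a chart `e` at `p`, as a map from `T_p M` to the model space. -/
noncomputable def chartDeriv (e : OpenPartialHomeomorph M (Model n)) (p : M) :
    Tan n p →L[ℝ] Model n :=
  mfderiv (𝓡 n) (𝓡 n) e p

/-- The vector field on `M` that is represented by `Y` in the chart `e` (meaningful on
`e.source`). -/
noncomputable def chartField (e : OpenPartialHomeomorph M (Model n)) (Y : Model n → Model n) :
    VField n M :=
  VectorField.mpullback (𝓡 n) (𝓡 n) e Y

theorem chartField_apply (e : OpenPartialHomeomorph M (Model n)) (Y : Model n → Model n) (p : M) :
    chartField e Y p = (chartDeriv e p).inverse (Y (e p)) := rfl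

variable {e : OpenPartialHomeomorph M (Model n)}

theorem mdifferentiable_of_mem_maximalAtlas (he : e ∈ IsManifold.maximalAtlas (𝓡 n) ∞ M) :
    e.MDifferentiable (𝓡 n) (𝓡 n) :=
  ⟨fun _ hp ↦ ((contMDiffAt_of_mem_maximalAtlas he hp).mdifferentiableAt
      (by simp)).mdifferentiableWithinAt,
    fun _ hp ↦ ((contMDiffAt_symm_of_mem_maximalAtlas he hp).mdifferentiableAt
      (by simp)).mdifferentiableWithinAt⟩

theorem isInvertible_chartDeriv (he : e ∈ IsManifold.maximalAtlas (𝓡 n) ∞ M) {p : M}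
    (hp : p ∈ e.source) : (chartDeriv e p).IsInvertible :=
  ⟨(mdifferentiable_of_mem_maximalAtlas he).mfderiv hp, rfl⟩

theorem chartDeriv_inverse (he : e ∈ IsManifold.maximalAtlas (𝓡 n) ∞ M) {p : M}
    (hp : p ∈ e.source) (v : Model n) : chartDeriv e p ((chartDeriv e p).inverse v) = v := by
  obtain ⟨A, hA⟩ := isInvertible_chartDeriv he hp
  rw [← hA, ContinuousLinearMap.inverse_equiv]
  exact A.apply_symm_apply v

theorem inverse_chartDeriv (he : e ∈ IsManifold.maximalAtlas (𝓡 n) ∞ M) {p : M}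
    (hp : p ∈ e.source) (v : Tan n p) : (chartDeriv e p).inverse (chartDeriv e p v) = v := by
  obtain ⟨A, hA⟩ := isInvertible_chartDeriv he hp
  rw [← hA, ContinuousLinearMap.inverse_equiv]
  exact A.symm_apply_apply v

theorem chartDeriv_chartField (he : e ∈ IsManifold.maximalAtlas (𝓡 n) ∞ M) {p : M}
    (hp : p ∈ e.source) (Y : Model n → Model n) : chartDeriv e p (chartField e Y p) = Y (e p) :=
  chartDeriv_inverse he hp _

theorem chartDeriv_trans (he : e ∈ IsManifold.maximalAtlas (𝓡 n) ∞ M)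
    {ψ : OpenPartialHomeomorph (Model n) (Model n)} (h1 : ContDiffOn ℝ ∞ ψ ψ.source) {p : M}
    (hp : p ∈ e.source) (hp' : e p ∈ ψ.source) (v : Tan n p) :
    chartDeriv (e.trans ψ) p v = fderiv ℝ ψ (e p) (chartDeriv e p v) := by
  have h2 : DifferentiableAt ℝ ψ (e p) :=
    (h1.contDiffAt (ψ.open_source.mem_nhds hp')).differentiableAt (by simp)
  have := mfderiv_comp (I := 𝓡 n) (I' := 𝓡 n) (I'' := 𝓡 n) p h2.mdifferentiableAt
    ((mdifferentiable_of_mem_maximalAtlas he).mdifferentiableAt hp)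
  rw [mfderiv_eq_fderiv] at this
  exact congrArg (fun T ↦ T v) this

theorem mvfderiv_comp_chart (he : e ∈ IsManifold.maximalAtlas (𝓡 n) ∞ M) {p : M}
    (hp : p ∈ e.source) {g : Model n → ℝ}
    (hg : DifferentiableAt ℝ g (e p)) (u : Tan n p) :
    mvfderiv (𝓡 n) (fun q ↦ g (e q)) p u = fderiv ℝ g (e p) (chartDeriv e p u) := by
  have := mvfderiv_comp_apply (I := 𝓡 n) (I' := 𝓡 n) p hg.mdifferentiableAt
    ((mdifferentiable_of_mem_maximalAtlas he).mdifferentiableAt hp) u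
  refine this.trans ?_
  rw [mvfderiv, mfderiv_eq_fderiv]
  rfl

theorem contDiffOn_comp_chart_symm (he : e ∈ IsManifold.maximalAtlas (𝓡 n) ∞ M) {N : Set M} {g : M → ℝ}
    (hg : ∃ G : M → ℝ, ContMDiff (𝓡 n) 𝓘(ℝ, ℝ) ∞ G ∧ ∀ p ∈ N, g p = G p) :
    ContDiffOn ℝ ∞ (fun z ↦ g (e.symm z)) (e.target ∩ e.symm ⁻¹' N) := by
  obtain ⟨G, hG, hgG⟩ := hg
  have h1 : ContMDiffOn (𝓡 n) 𝓘(ℝ, ℝ) ∞ (G ∘ e.symm) e.target :=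
    hG.comp_contMDiffOn (contMDiffOn_symm_of_mem_maximalAtlas he)
  exact (h1.contDiffOn.mono inter_subset_left).congr fun z hz ↦ hgG _ hz.2

variable [IsManifold (𝓡 n) ∞ M]

theorem contMDiffAt_chartField (he : e ∈ IsManifold.maximalAtlas (𝓡 n) ∞ M) {p : M}
    (hp : p ∈ e.source) {Y : Model n → Model n} (hY : ContDiffAt ℝ ∞ Y (e p)) :
    ContMDiffAt (𝓡 n) ((𝓡 n).prod 𝓘(ℝ, Model n)) ∞
      (fun q ↦ TotalSpace.mk' (Model n) (E := fun q : M ↦ Tan n q) q (chartField e Y q)) p := by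
  have h1 := contMDiffAt_vectorSpace_iff_contDiffAt.2 hY
  have : IsManifold (𝓡 n) 1 M := IsManifold.of_le (n := ∞) (by simp)
  exact ContMDiffAt.mpullback_vectorField_preimage (n := ∞) h1 (contMDiffAt_of_mem_maximalAtlas he hp)
    (isInvertible_chartDeriv he hp) (by simp)

theorem vFieldDiffAt_chartField (he : e ∈ IsManifold.maximalAtlas (𝓡 n) ∞ M) {p : M}
    (hp : p ∈ e.source) {Y : Model n → Model n} (hY : DifferentiableAt ℝ Y (e p)) :
    VFieldDiffAt (chartField e Y) p := by
  have h1 : MDifferentiableAt (𝓡 n) ((𝓡 n).prod 𝓘(ℝ, Model n))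
      (fun q ↦ TotalSpace.mk' (Model n) (E := fun q : Model n ↦ TangentSpace (𝓡 n) q) q (Y q))
      (e p) := by
    rw [mdifferentiableAt_totalSpace]
    refine ⟨mdifferentiableAt_id, ?_⟩
    convert! hY.mdifferentiableAt with y
    simp
  have : IsManifold (𝓡 n) 2 M := IsManifold.of_le (n := ∞) (WithTop.coe_le_coe.2 le_top)
  exact MDifferentiableAt.mpullback_vectorField (n := ∞) h1 (contMDiffAt_of_mem_maximalAtlas he hp)
    (isInvertible_chartDeriv he hp) (WithTop.coe_le_coe.2 le_top)

/-- Composing a chart with a diffeomorphism of open subsets of the model space gives a chart. -/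
theorem trans_mem_maximalAtlas (he : e ∈ IsManifold.maximalAtlas (𝓡 n) ∞ M)
    {ψ : OpenPartialHomeomorph (Model n) (Model n)} (h1 : ContDiffOn ℝ ∞ ψ ψ.source)
    (h2 : ContDiffOn ℝ ∞ ψ.symm ψ.target) :
    e.trans ψ ∈ IsManifold.maximalAtlas (𝓡 n) ∞ M := by
  rw [IsManifold.mem_maximalAtlas_iff_contMDiffOn] at he ⊢
  exact ⟨h1.contMDiffOn.comp (he.1.mono fun _ hp ↦ hp.1) fun _ hp ↦ hp.2,
    he.2.comp (h2.contMDiffOn.mono fun _ hp ↦ hp.1) fun _ hp ↦ hp.2⟩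

end GPH

/-! ### Global fields that are constant in a chart -/

namespace GPH

open Bundle

variable {n : ℕ} {M : Type*} [TopologicalSpace M] [ChartedSpace (Model n) M]
  [IsManifold (𝓡 n) ∞ M] {e : OpenPartialHomeomorph M (Model n)}

theorem smoothOneForm_mfderiv {g : M → ℝ} (hg : ContMDiff (𝓡 n) 𝓘(ℝ, ℝ) ∞ g) :
    SmoothOneForm (n := n) (fun p ↦ (mfderiv (𝓡 n) 𝓘(ℝ, ℝ) g p : Tan n p →L[ℝ] ℝ)) := by
  intro p
  rw [contMDiffAt_hom_bundle]
  refine ⟨contMDiffAt_id, ?_⟩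
  have : IsManifold (𝓡 n) 1 M := IsManifold.of_le (n := ∞) (by simp)
  have := ContMDiffAt.mfderiv_const (m := ∞) (n := ∞) hg.contMDiffAt (x₀ := p) (by simp)
  convert! this using 2 with q
  simp only [inTangentCoordinates, ContinuousLinearMap.inCoordinates]
  erw [Bundle.Trivial.continuousLinearMapAt_trivialization,
    TangentBundle.continuousLinearMapAt_model_space]
  rfl

/-- An open part `N` of the domain of the chart `e` on which the constant vector fields and the
constant one-forms of the chart coincide with smooth fields defined on all of `M`. -/
structure IsExtensionDomain (e : OpenPartialHomeomorph M (Model n)) (N : Set M) : Prop where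
  isOpen : IsOpen N
  subset : N ⊆ e.source
  exists_vField : ∀ v : Model n, ∃ Z : VField n M, SmoothVField Z ∧
    ∀ p ∈ N, Z p = chartField e (fun _ ↦ v) p
  exists_oneForm : ∀ a : Model n →L[ℝ] ℝ, ∃ η : OneForm n M, SmoothOneForm η ∧
    ∀ p ∈ N, η p = a ∘L chartDeriv e p

/-- Multiplication by a bump function extends local fields. -/
theorem exists_isExtensionDomain [T2Space M] (he : e ∈ IsManifold.maximalAtlas (𝓡 n) ∞ M) {x : M}
    (hx : x ∈ e.source) : ∃ N : Set M, x ∈ N ∧ IsExtensionDomain e N := by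
  obtain ⟨ρ, -, hρ⟩ := (SmoothBumpFunction.nhds_basis_tsupport (I := 𝓡 n) x).mem_iff.1
    (e.open_source.mem_nhds hx)
  have hρs := ρ.contMDiff
  have h1 : ∀ p ∈ interior {p | ρ p = 1}, ρ p = 1 := fun p hp ↦ by
    simpa using! interior_subset hp
  have hN : interior {p | ρ p = 1} ⊆ e.source := fun p hp ↦
    hρ (subset_tsupport _ (by simp [h1 p hp]))
  refine ⟨interior {p | ρ p = 1}, mem_interior_iff_mem_nhds.2 ρ.eventuallyEq_one,
    isOpen_interior, hN, ?_, ?_⟩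
  · intro v
    refine ⟨fun p ↦ ρ p • chartField e (fun _ ↦ v) p, ?_, ?_⟩
    · exact ContMDiffOn.smul_section_of_tsupport hρs.contMDiffOn e.open_source hρ
        fun p hp ↦ (contMDiffAt_chartField he hp contDiffAt_const).contMDiffWithinAt
    · intro p hp
      simp [h1 p hp]
  · intro a
    have hs : ContMDiff (𝓡 n) 𝓘(ℝ, ℝ) ∞ (fun p ↦ ρ p • a (e p)) := by
      apply contMDiff_of_tsupport
      intro p hp
      have hp' : p ∈ e.source := hρ (closure_mono (Function.support_smul_subset_left _ _) hp)
      exact hρs.contMDiffAt.smul (a.contDiff.contMDiff.contMDiffAt.comp p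
        (contMDiffAt_of_mem_maximalAtlas he hp'))
    refine ⟨_, smoothOneForm_mfderiv hs, fun p hp ↦ ?_⟩
    have h2 : (fun q ↦ ρ q • a (e q)) =ᶠ[𝓝 p] a ∘ e := by
      filter_upwards [isOpen_interior.mem_nhds hp] with q hq
      simp [h1 q hq]
    rw [h2.mfderiv_eq, mfderiv_comp (I' := 𝓡 n) p
      a.differentiableAt.mdifferentiableAt ((mdifferentiable_of_mem_maximalAtlas he).mdifferentiableAt (hN hp)),
      mfderiv_eq_fderiv, a.fderiv]
    rfl

end GPH

/-! ### The connection in a chart -/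

namespace GPH

open Bundle

variable {n : ℕ} {M : Type*} [TopologicalSpace M] [ChartedSpace (Model n) M]
  [IsManifold (𝓡 n) ∞ M] {e : OpenPartialHomeomorph M (Model n)}

/-- The Christoffel symbols of `D` at the point `p` in the chart `e`, as the bilinear map
`(u, w) ↦ ∇_u w` for constant fields `u` and `w` of the chart. -/
noncomputable def christoffelAt (D : Connection n M) (e : OpenPartialHomeomorph M (Model n))
    (p : M) : Model n →L[ℝ] Model n →L[ℝ] Model n :=
  ∑ k, ContinuousLinearMap.smulRightL ℝ (Model n) (Model n)
      (EuclideanSpace.proj k) ∘L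
    (chartDeriv e p ∘L D (chartField e fun _ ↦ EuclideanSpace.single k 1) p ∘L
      (chartDeriv e p).inverse)

theorem christoffelAt_apply (D : Connection n M) (p : M) (u w : Model n) :
    christoffelAt D e p u w = ∑ k, w k • chartDeriv e p
      (D (chartField e fun _ ↦ EuclideanSpace.single k 1) p ((chartDeriv e p).inverse u)) := by
  simp [christoffelAt]

theorem connection_sum_smul (D : Connection n M) {ι : Type*} (s : Finset ι) {p : M} {g : ι → M → ℝ}
    {σ : ι → VField n M} (hg : ∀ k, MDifferentiableAt (𝓡 n) 𝓘(ℝ, ℝ) (g k) p)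
    (hσ : ∀ k, VFieldDiffAt (σ k) p) :
    D (∑ k ∈ s, g k • σ k) p =
      ∑ k ∈ s, (g k p • D (σ k) p + (mvfderiv (𝓡 n) (g k) p).smulRight (σ k p)) := by
  classical
  have h0 : ∀ k, VFieldDiffAt (g k • σ k) p := fun k ↦ (hg k).smul_section (hσ k)
  induction s using Finset.induction_on with
  | empty => exact D.isCovariantDerivativeOn.zero (mem_univ p)
  | insert k s hk ih =>
    have h1 : VFieldDiffAt (∑ k ∈ s, g k • σ k) p := by
      rw [show (∑ k ∈ s, g k • σ k) = fun q ↦ ∑ k ∈ s, (g k • σ k) q from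
        funext fun q ↦ Finset.sum_apply ..]
      exact MDifferentiableAt.sum_section fun k _ ↦ h0 k
    rw [Finset.sum_insert hk, Finset.sum_insert hk, D.isCovariantDerivativeOn.add (h0 k) h1, ih,
      D.isCovariantDerivativeOn.leibniz (hσ k) (hg k)]

/-- The covariant derivative in a chart. -/
theorem chartDeriv_connection (D : Connection n M)
    (he : e ∈ IsManifold.maximalAtlas (𝓡 n) ∞ M) {p : M}
    (hp : p ∈ e.source) {Y : Model n → Model n} (hY : DifferentiableAt ℝ Y (e p)) (u : Tan n p) :
    chartDeriv e p (D (chartField e Y) p u) =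
      fderiv ℝ Y (e p) (chartDeriv e p u) + christoffelAt D e p (chartDeriv e p u) (Y (e p)) := by
  have hY' : chartField e Y = ∑ k, (fun q ↦ Y (e q) k) •
      chartField e (fun _ ↦ EuclideanSpace.single k 1) := by
    ext1 q
    have : Y (e q) = ∑ k, Y (e q) k • EuclideanSpace.single k (1 : ℝ) := by
      ext i; simp [Finset.sum_apply, Pi.single_apply]
    rw [chartField_apply, this, map_sum]
    simp [chartField_apply]
  have hYk : ∀ k, DifferentiableAt ℝ (fun z ↦ Y z k) (e p) := fun k ↦
    (EuclideanSpace.proj (𝕜 := ℝ) k).differentiableAt.comp _ hY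
  have hYk' : ∀ k, MDifferentiableAt (𝓡 n) 𝓘(ℝ, ℝ) (fun q ↦ Y (e q) k) p := fun k ↦
    (hYk k).mdifferentiableAt.comp p ((mdifferentiable_of_mem_maximalAtlas he).mdifferentiableAt hp)
  rw [hY', connection_sum_smul D _ hYk'
    fun k ↦ vFieldDiffAt_chartField he hp (differentiableAt_const _), christoffelAt_apply,
    inverse_chartDeriv he hp]
  have h1 : fderiv ℝ Y (e p) (chartDeriv e p u) = ∑ k,
      fderiv ℝ (fun z ↦ Y z k) (e p) (chartDeriv e p u) • EuclideanSpace.single k (1 : ℝ) := by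
    ext i
    have := (EuclideanSpace.proj (𝕜 := ℝ) i).hasFDerivAt.comp (e p) hY.hasFDerivAt
    have := this.fderiv
    simp only [Function.comp_def, PiLp.proj_apply] at this
    simp [Finset.sum_apply, Pi.single_apply, this]
  rw [h1, _root_.sum_apply, map_sum, ← Finset.sum_add_distrib]
  refine Finset.sum_congr rfl fun k _ ↦ ?_
  rw [_root_.add_apply, map_add, _root_.smul_apply, map_smul,
    ContinuousLinearMap.smulRight_apply, map_smul, chartDeriv_chartField he hp,
    mvfderiv_comp_chart he hp (hYk k), add_comm]

end GPH

namespace GPH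

open Bundle

variable {n : ℕ} {M : Type*} [TopologicalSpace M] [ChartedSpace (Model n) M]
  [IsManifold (𝓡 n) ∞ M] {e : OpenPartialHomeomorph M (Model n)}

/-- The covariant derivative in a chart, for fields with the given representation near `p` only. -/
theorem chartDeriv_connection_of_eventuallyEq (D : Connection n M)
    (he : e ∈ IsManifold.maximalAtlas (𝓡 n) ∞ M) {p : M}
    (hp : p ∈ e.source) {Y : Model n → Model n} (hY : DifferentiableAt ℝ Y (e p)) {Z : VField n M}
    (hZ : ∀ᶠ q in 𝓝 p, Z q = chartField e Y q) (u : Tan n p) :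
    chartDeriv e p (D Z p u) =
      fderiv ℝ Y (e p) (chartDeriv e p u) + christoffelAt D e p (chartDeriv e p u) (Y (e p)) := by
  have h1 := vFieldDiffAt_chartField he hp hY
  have h2 : VFieldDiffAt Z p := by
    refine h1.congr_of_eventuallyEq ?_
    filter_upwards [hZ] with q hq
    rw [hq]
  rw [← chartDeriv_connection D he hp hY]
  exact congrArg (fun T ↦ chartDeriv e p (T u))
    (D.isCovariantDerivativeOn.congr_of_eventuallyEq h2 h1 Filter.univ_mem hZ)

/-- The Christoffel symbols of `D` as functions of the coordinates of the chart `e`. -/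
noncomputable def christoffel (D : Connection n M) (e : OpenPartialHomeomorph M (Model n))
    (z : Model n) : Model n →L[ℝ] Model n →L[ℝ] Model n :=
  christoffelAt D e (e.symm z)

variable {N : Set M}

theorem chartDeriv_connection_const (D : Connection n M)
    (he : e ∈ IsManifold.maximalAtlas (𝓡 n) ∞ M) (hN : IsExtensionDomain e N) {p : M} (hp : p ∈ N)
    {w : Model n} {Z : VField n M} (hZ : ∀ q ∈ N, Z q = chartField e (fun _ ↦ w) q)
    (u : Tan n p) : chartDeriv e p (D Z p u) = christoffelAt D e p (chartDeriv e p u) w := by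
  rw [chartDeriv_connection_of_eventuallyEq D he (hN.subset hp) (differentiableAt_const w)
    (Filter.eventually_of_mem (hN.isOpen.mem_nhds hp) hZ)]
  simp

theorem contMDiff_pair {α : OneForm n M} {Y : VField n M} (hα : SmoothOneForm α)
    (hY : SmoothVField Y) : ContMDiff (𝓡 n) 𝓘(ℝ, ℝ) ∞ (fun q ↦ α q (Y q)) := by
  have := ContMDiff.clm_bundle_apply (𝕜 := ℝ) (F₁ := Model n) (F₂ := ℝ)
    (E₁ := fun q : M ↦ Tan n q) (E₂ := Bundle.Trivial M ℝ) (IM := 𝓡 n) (IB := 𝓡 n)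
    (b := fun q : M ↦ q) (ϕ := α) (v := Y) hα hY
  intro p
  have := this p
  simp only [contMDiffAt_totalSpace] at this
  exact this.2

theorem SmoothVField.nabla {D : Connection n M}
    (hD : ContMDiffCovariantDerivativeOn (Model n) ∞ D.toFun (Set.univ : Set M))
    {X Y : VField n M} (hX : SmoothVField X) (hY : SmoothVField Y) :
    SmoothVField (nabla D X Y) := by
  have h1 := contMDiffOn_univ.1 (hD.contMDiff (σ := Y) (contMDiffOn_univ.2 hY))
  exact ContMDiff.clm_bundle_apply (𝕜 := ℝ) (F₁ := Model n) (F₂ := Model n)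
    (E₁ := fun q : M ↦ Tan n q) (E₂ := fun q : M ↦ Tan n q) (IM := 𝓡 n) (IB := 𝓡 n)
    (b := fun q : M ↦ q) (ϕ := fun q ↦ D Y q) (v := X) h1 hX

theorem contDiffOn_christoffel {D : Connection n M}
    (hD : ContMDiffCovariantDerivativeOn (Model n) ∞ D.toFun (Set.univ : Set M))
    (he : e ∈ IsManifold.maximalAtlas (𝓡 n) ∞ M) (hN : IsExtensionDomain e N) :
    ContDiffOn ℝ ∞ (christoffel D e) (e.target ∩ e.symm ⁻¹' N) := by
  refine contDiffOn_clm_apply.2 fun u ↦ contDiffOn_clm_apply.2 fun w ↦ contDiffOn_euclidean.2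
    fun i ↦ ?_
  refine contDiffOn_comp_chart_symm he (g := fun p ↦ christoffelAt D e p u w i) ?_
  obtain ⟨U, hU, hU'⟩ := hN.exists_vField u
  obtain ⟨W, hW, hW'⟩ := hN.exists_vField w
  obtain ⟨η, hη, hη'⟩ := hN.exists_oneForm (EuclideanSpace.proj i)
  refine ⟨_, contMDiff_pair hη (hU.nabla hD hW), fun p hp ↦ ?_⟩
  have := chartDeriv_connection_const D he hN hp hW' (U p)
  rw [hU' p hp, chartDeriv_chartField he (hN.subset hp)] at this
  rw [hη' p hp, nabla, ContinuousLinearMap.comp_apply, hU' p hp, this]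
  rfl

/-- Constant vector fields of a chart commute. -/
theorem mlieBracket_chartField_const (he : e ∈ IsManifold.maximalAtlas (𝓡 n) ∞ M) {p : M}
    (hp : p ∈ e.source) (v w : Model n) :
    VectorField.mlieBracket (𝓡 n) (chartField e fun _ ↦ v) (chartField e fun _ ↦ w) p = 0 := by
  have h1 : ∀ v : Model n, MDifferentiableAt (𝓡 n) ((𝓡 n).prod 𝓘(ℝ, Model n))
      (fun q ↦ TotalSpace.mk' (Model n) (E := fun q : Model n ↦ TangentSpace (𝓡 n) q) q v)
      (e p) := fun v ↦
    (contMDiffAt_vectorSpace_iff_contDiffAt.2 (contDiffAt_const (n := ∞))).mdifferentiableAt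
      (by simp)
  have : IsManifold (𝓡 n) (minSmoothness ℝ 3) M := IsManifold.of_le (n := ∞)
    (by rw [minSmoothness_of_isRCLikeNormedField]
        exact WithTop.coe_le_coe.2 (le_top : (3 : ℕ∞) ≤ ⊤))
  have := VectorField.mpullback_mlieBracket (I := 𝓡 n) (I' := 𝓡 n) (h1 v) (h1 w)
    (contMDiffAt_of_mem_maximalAtlas he hp) (n := ∞)
    (by rw [minSmoothness_of_isRCLikeNormedField]
        exact WithTop.coe_le_coe.2 (le_top : (2 : ℕ∞) ≤ ⊤))
  refine this.symm.trans ?_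
  rw [VectorField.mpullback_apply]
  have h2 : VectorField.mlieBracket (𝓡 n) (fun _ : Model n ↦ v) (fun _ ↦ w) (e p) = 0 := by
    have h3 := congrFun (VectorField.mlieBracketWithin_eq_lieBracketWithin (𝕜 := ℝ)
      (V := fun _ : Model n ↦ v) (W := fun _ ↦ w) (s := univ)) (e p)
    refine (congrFun (VectorField.mlieBracketWithin_univ (𝕜 := ℝ) (I := 𝓡 n)).symm
      (e p)).trans (h3.trans ?_)
    simp [VectorField.lieBracket, VectorField.lieBracketWithin_univ]
    rfl
  erw [h2, map_zero]

/-- Vanishing torsion in a chart. -/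
theorem christoffelAt_symm {D : Connection n M} (hD : D.torsion = 0)
    (he : e ∈ IsManifold.maximalAtlas (𝓡 n) ∞ M) {p : M} (hp : p ∈ e.source) (v w : Model n) :
    christoffelAt D e p v w = christoffelAt D e p w v := by
  have h1 : ∀ v : Model n, VFieldDiffAt (chartField e fun _ ↦ v) p := fun v ↦
    vFieldDiffAt_chartField he hp (differentiableAt_const v)
  have h2 := (CovariantDerivative.torsion_eq_zero_iff D).1 hD (h1 v) (h1 w)
  rw [mlieBracket_chartField_const he hp, sub_eq_zero] at h2
  have h3 := congrArg (chartDeriv e p) h2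
  simpa [chartDeriv_connection D he hp (differentiableAt_const _),
    chartDeriv_chartField he hp] using h3

/-- Flatness in a chart. -/
theorem christoffel_flat {D : Connection n M}
    (hD : ContMDiffCovariantDerivativeOn (Model n) ∞ D.toFun (Set.univ : Set M))
    (hflat : IsFlat D) (he : e ∈ IsManifold.maximalAtlas (𝓡 n) ∞ M) (hN : IsExtensionDomain e N)
    {z : Model n} (hz : z ∈ e.target ∩ e.symm ⁻¹' N) (v w : Model n) :
    fderiv ℝ (christoffel D e) z v w - fderiv ℝ (christoffel D e) z w v +
      christoffel D e z v * christoffel D e z w - christoffel D e z w * christoffel D e z v = 0 := by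
  have hO : IsOpen (e.target ∩ e.symm ⁻¹' N) := e.symm.isOpen_inter_preimage hN.isOpen
  have hΓ : DifferentiableAt ℝ (christoffel D e) z :=
    ((contDiffOn_christoffel hD he hN).contDiffAt (hO.mem_nhds hz)).differentiableAt (by simp)
  obtain ⟨p, hp, rfl⟩ : ∃ p ∈ N, e p = z := ⟨e.symm z, hz.2, e.right_inv hz.1⟩
  have hpe := hN.subset hp
  have hc : ∀ q ∈ N, christoffel D e (e q) = christoffelAt D e q := fun q hq ↦ by
    rw [christoffel, e.left_inv (hN.subset hq)]
  ext1 b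
  obtain ⟨V, hV, hV'⟩ := hN.exists_vField v
  obtain ⟨W, hW, hW'⟩ := hN.exists_vField w
  obtain ⟨B, hB, hB'⟩ := hN.exists_vField b
  have key : ∀ {v w : Model n} {V W : VField n M}, (∀ q ∈ N, V q = chartField e (fun _ ↦ v) q) →
      (∀ q ∈ N, W q = chartField e (fun _ ↦ w) q) →
      chartDeriv e p (D (nabla D W B) p (V p)) = fderiv ℝ (christoffel D e) (e p) v w b +
        christoffelAt D e p v (christoffelAt D e p w b) := by
    intro v w V W hV hW
    have h1 : ∀ᶠ q in 𝓝 p, nabla D W B q = chartField e (fun z ↦ christoffel D e z w b) q := by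
      filter_upwards [hN.isOpen.mem_nhds hp] with q hq
      have hqe := hN.subset hq
      have := chartDeriv_connection_const D he hN hq hB' (W q)
      rw [hW q hq, chartDeriv_chartField he hqe] at this
      rw [chartField_apply, hc q hq, ← this, inverse_chartDeriv he hqe, nabla, hW q hq]
    have h2 : HasFDerivAt (fun z ↦ christoffel D e z w b) _ (e p) :=
      (hΓ.hasFDerivAt.clm_apply (hasFDerivAt_const w _)).clm_apply (hasFDerivAt_const b _)
    rw [chartDeriv_connection_of_eventuallyEq D he hpe h2.differentiableAt h1, h2.fderiv, hV p hp,
      chartDeriv_chartField he hpe, hc p hp]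
    simp
  have hbr : VectorField.mlieBracket (𝓡 n) V W p = 0 := by
    rw [← mlieBracket_chartField_const he hpe v w]
    exact Filter.EventuallyEq.mlieBracket_vectorField_eq
      (Filter.eventually_of_mem (hN.isOpen.mem_nhds hp) hV')
      (Filter.eventually_of_mem (hN.isOpen.mem_nhds hp) hW')
  have h3 := congrFun (hflat V W B hV hW hB) p
  have h4 : D (nabla D W B) p (V p) - D (nabla D V B) p (W p) = 0 := by
    have h5 : nabla D (VectorField.mlieBracket (𝓡 n) V W) B p = 0 := by
      rw [nabla, hbr, map_zero]
    change nabla D V (nabla D W B) p - nabla D W (nabla D V B) p -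
      nabla D (VectorField.mlieBracket (𝓡 n) V W) B p = 0 at h3
    rwa [h5, sub_zero] at h3
  have h5 := congrArg (chartDeriv e p) h4
  rw [map_sub, key hV' hW', key hW' hV', map_zero] at h5
  simp only [hc p hp, mul_apply_eq_comp, _root_.add_apply, _root_.sub_apply,
    _root_.zero_apply]
  rw [← h5]
  abel

end GPH

/-! ### Bivector fields in a chart -/

namespace GPH

open Bundle
open scoped RealInnerProductSpace

variable {n : ℕ} {M : Type*} [TopologicalSpace M] [ChartedSpace (Model n) M]

/-- The covector at `p` that the chart `e` represents by the linear form `⟪a, ·⟫`. -/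
noncomputable def chartCovector (e : OpenPartialHomeomorph M (Model n)) (p : M) :
    Model n →ₗ[ℝ] Cotan n p where
  toFun a := innerSL ℝ a ∘L chartDeriv e p
  map_add' a b := by ext v; simp
  map_smul' c a := by ext v; simp

/-- The map `h_#` at `p` read in the chart `e`, with the model space identified with its dual. -/
noncomputable def chartSharpAt (h : Bivector n M) (e : OpenPartialHomeomorph M (Model n)) (p : M) :
    Model n →L[ℝ] Model n :=
  LinearMap.toContinuousLinearMap
    ((chartDeriv e p).toLinearMap ∘ₗ sharp h p ∘ₗ chartCovector e p)

/-- The map `h_#` as a function of the coordinates of the chart `e`. -/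
noncomputable def chartSharp (h : Bivector n M) (e : OpenPartialHomeomorph M (Model n))
    (z : Model n) : Model n →L[ℝ] Model n :=
  chartSharpAt h e (e.symm z)

variable {e : OpenPartialHomeomorph M (Model n)} {h : Bivector n M}

theorem chartCovector_apply (p : M) (a : Model n) (v : Tan n p) :
    chartCovector e p a v = ⟪a, chartDeriv e p v⟫ := rfl

theorem chartSharpAt_apply (p : M) (a : Model n) :
    chartSharpAt h e p a = chartDeriv e p (sharp h p (chartCovector e p a)) := rfl

theorem inner_chartSharpAt (p : M) (a b : Model n) :
    ⟪b, chartSharpAt h e p a⟫ = h p (chartCovector e p a) (chartCovector e p b) := by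
  rw [← apply_sharp]
  rfl

theorem chartCovector_bijective (he : e ∈ IsManifold.maximalAtlas (𝓡 n) ∞ M) {p : M}
    (hp : p ∈ e.source) : Function.Bijective (chartCovector e p) := by
  constructor
  · intro a b hab
    refine ext_inner_right ℝ fun v ↦ ?_
    have := congrArg (fun T ↦ T ((chartDeriv e p).inverse v)) hab
    simpa only [chartCovector_apply, chartDeriv_inverse he hp] using this
  · intro α
    refine ⟨(InnerProductSpace.toDual ℝ (Model n)).symm (α ∘L (chartDeriv e p).inverse), ?_⟩
    ext v
    rw [chartCovector_apply, InnerProductSpace.toDual_symm_apply, ContinuousLinearMap.comp_apply,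
      inverse_chartDeriv he hp]

theorem finrank_range_chartSharpAt (he : e ∈ IsManifold.maximalAtlas (𝓡 n) ∞ M) {p : M}
    (hp : p ∈ e.source) :
    Module.finrank ℝ (LinearMap.range (chartSharpAt h e p).toLinearMap) = rank h p := by
  obtain ⟨A, hA⟩ := isInvertible_chartDeriv he hp
  have h1 : (chartSharpAt h e p).toLinearMap =
      A.toLinearEquiv.toLinearMap ∘ₗ sharp h p ∘ₗ chartCovector e p := by
    rw [chartSharpAt, ← hA]
    rfl
  rw [h1, LinearMap.range_comp, LinearMap.range_comp, LinearMap.range_eq_top.2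
    (chartCovector_bijective he hp).2, Submodule.map_top, rank]
  exact LinearEquiv.finrank_map_eq _ _

variable [IsManifold (𝓡 n) ∞ M] {N : Set M}

theorem contMDiff_bivector_apply (hh : SmoothBivector h) {α β : OneForm n M}
    (hα : SmoothOneForm α) (hβ : SmoothOneForm β) :
    ContMDiff (𝓡 n) 𝓘(ℝ, ℝ) ∞ (fun q ↦ h q (α q) (β q)) := by
  have := ContMDiff.clm_bundle_apply₂ (𝕜 := ℝ) (F₁ := Model n →L[ℝ] ℝ) (F₂ := Model n →L[ℝ] ℝ)
    (F₃ := ℝ) (E₁ := fun q : M ↦ Cotan n q) (E₂ := fun q : M ↦ Cotan n q)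
    (E₃ := Bundle.Trivial M ℝ) (IM := 𝓡 n) (IB := 𝓡 n)
    (b := fun q : M ↦ q) (ψ := h) (v := α) (w := β) hh hα hβ
  intro p
  have := this p
  simp only [contMDiffAt_totalSpace] at this
  exact this.2

theorem IsExtensionDomain.exists_eq_chartCovector (hN : IsExtensionDomain e N) (a : Model n) :
    ∃ η : OneForm n M, SmoothOneForm η ∧ ∀ p ∈ N, η p = chartCovector e p a :=
  hN.exists_oneForm (innerSL ℝ a)

theorem contDiffOn_chartSharp (hh : SmoothBivector h)
    (he : e ∈ IsManifold.maximalAtlas (𝓡 n) ∞ M) (hN : IsExtensionDomain e N) :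
    ContDiffOn ℝ ∞ (chartSharp h e) (e.target ∩ e.symm ⁻¹' N) := by
  refine contDiffOn_clm_apply.2 fun a ↦ contDiffOn_euclidean.2 fun i ↦ ?_
  refine contDiffOn_comp_chart_symm he (g := fun p ↦ chartSharpAt h e p a i) ?_
  obtain ⟨α, hα, hα'⟩ := hN.exists_eq_chartCovector a
  obtain ⟨β, hβ, hβ'⟩ := hN.exists_eq_chartCovector (EuclideanSpace.single i 1)
  refine ⟨_, contMDiff_bivector_apply hh hα hβ, fun p hp ↦ ?_⟩
  rw [hα' p hp, hβ' p hp, ← inner_chartSharpAt]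
  simp [EuclideanSpace.inner_single_left]

/-- The dual connection on constant one-forms of a chart. -/
theorem dualDeriv_chartCovector (D : Connection n M)
    (he : e ∈ IsManifold.maximalAtlas (𝓡 n) ∞ M) (hN : IsExtensionDomain e N) {p : M} (hp : p ∈ N)
    {b : Model n} {β : OneForm n M} (hβ : SmoothOneForm β)
    (hβ' : ∀ q ∈ N, β q = chartCovector e q b) (v w : Tan n p) :
    dualDeriv D β p v w = -⟪b, christoffelAt D e p (chartDeriv e p v) (chartDeriv e p w)⟫ := by
  have hpe := hN.subset hp
  obtain ⟨W, hW, hW'⟩ := hN.exists_vField (chartDeriv e p w)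
  have hWp : W p = w := by
    rw [hW' p hp, chartField_apply, inverse_chartDeriv he hpe]
  have h1 : (fun q ↦ β q (W q)) =ᶠ[𝓝 p] fun _ ↦ ⟪b, chartDeriv e p w⟫ := by
    filter_upwards [hN.isOpen.mem_nhds hp] with q hq
    rw [hβ' q hq, hW' q hq, chartCovector_apply, chartDeriv_chartField he (hN.subset hq)]
  have h2 : mvfderiv (𝓡 n) (fun q ↦ β q (W q)) p v = 0 :=
    (congrArg (fun T : Model n →L[ℝ] ℝ ↦ T v) h1.mfderiv_eq).trans
      (congrArg (fun T : Tan n p →L[ℝ] ℝ ↦ T v) (mvfderiv_const (I := 𝓡 n) _))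
  rw [← hWp, dualDeriv_apply D (hβ.mdifferentiableAt (by simp)) (hW.mdifferentiableAt (by simp)),
    h2, hβ' p hp, chartCovector_apply, chartDeriv_connection_const D he hN hp hW', hWp, zero_sub]

/-- The covariant derivative of a bivector field in a chart. -/
theorem covDeriv_chartCovector (D : Connection n M) (hh : SmoothBivector h)
    (hsymm : ∀ p α β, h p α β = h p β α)
    (he : e ∈ IsManifold.maximalAtlas (𝓡 n) ∞ M) (hN : IsExtensionDomain e N) {p : M} (hp : p ∈ N)
    {b c : Model n} {β γ : OneForm n M} (hβ : SmoothOneForm β) (hγ : SmoothOneForm γ)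
    (hβ' : ∀ q ∈ N, β q = chartCovector e q b) (hγ' : ∀ q ∈ N, γ q = chartCovector e q c)
    (v : Tan n p) :
    covDeriv D h p v β γ =
      ⟪fderiv ℝ (chartSharp h e) (e p) (chartDeriv e p v) b, c⟫ +
      ⟪b, christoffelAt D e p (chartDeriv e p v) (chartSharpAt h e p c)⟫ +
      ⟪christoffelAt D e p (chartDeriv e p v) (chartSharpAt h e p b), c⟫ := by
  have hpe := hN.subset hp
  have hO : IsOpen (e.target ∩ e.symm ⁻¹' N) := e.symm.isOpen_inter_preimage hN.isOpen
  have hS : DifferentiableAt ℝ (chartSharp h e) (e p) :=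
    ((contDiffOn_chartSharp hh he hN).contDiffAt (hO.mem_nhds
      ⟨e.map_source hpe, by simpa [e.left_inv hpe] using hp⟩)).differentiableAt (by simp)
  have h1 : (fun q ↦ h q (β q) (γ q)) =ᶠ[𝓝 p] fun q ↦ ⟪chartSharp h e (e q) b, c⟫ := by
    filter_upwards [hN.isOpen.mem_nhds hp] with q hq
    rw [hβ' q hq, hγ' q hq, ← inner_chartSharpAt, real_inner_comm, chartSharp,
      e.left_inv (hN.subset hq)]
  have h2 : HasFDerivAt (fun z ↦ ⟪chartSharp h e z b, c⟫) _ (e p) :=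
    (hS.hasFDerivAt.clm_apply (hasFDerivAt_const b _)).inner ℝ (hasFDerivAt_const c _)
  have h3 : mvfderiv (𝓡 n) (fun q ↦ h q (β q) (γ q)) p v =
      ⟪fderiv ℝ (chartSharp h e) (e p) (chartDeriv e p v) b, c⟫ := by
    refine ((congrArg (fun T : Model n →L[ℝ] ℝ ↦ T v) h1.mfderiv_eq).trans
      (mvfderiv_comp_chart he hpe h2.differentiableAt v)).trans ?_
    rw [h2.fderiv]
    simp
  rw [covDeriv, h3, hsymm p (dualDeriv D β p v), ← apply_sharp, ← apply_sharp,
    dualDeriv_chartCovector D he hN hp hβ hβ', dualDeriv_chartCovector D he hN hp hγ hγ',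
    hβ' p hp, hγ' p hp, ← chartSharpAt_apply, ← chartSharpAt_apply,
    real_inner_comm c (christoffelAt D e p _ _)]
  ring

/-- The Codazzi equation in a chart. -/
theorem chartSharp_codazzi {D : Connection n M} (hh : IsGeneralizedPseudoHessian D h)
    (he : e ∈ IsManifold.maximalAtlas (𝓡 n) ∞ M) (hN : IsExtensionDomain e N) {z : Model n}
    (hz : z ∈ e.target ∩ e.symm ⁻¹' N) (a b c : Model n) :
    ⟪fderiv ℝ (chartSharp h e) z (chartSharp h e z a) b, c⟫ +
      ⟪b, christoffel D e z (chartSharp h e z a) (chartSharp h e z c)⟫ +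
      ⟪christoffel D e z (chartSharp h e z a) (chartSharp h e z b), c⟫ =
    ⟪fderiv ℝ (chartSharp h e) z (chartSharp h e z b) a, c⟫ +
      ⟪a, christoffel D e z (chartSharp h e z b) (chartSharp h e z c)⟫ +
      ⟪christoffel D e z (chartSharp h e z b) (chartSharp h e z a), c⟫ := by
  obtain ⟨p, hp, rfl⟩ : ∃ p ∈ N, e p = z := ⟨e.symm z, hz.2, e.right_inv hz.1⟩
  obtain ⟨α, hα, hα'⟩ := hN.exists_eq_chartCovector a
  obtain ⟨β, hβ, hβ'⟩ := hN.exists_eq_chartCovector b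
  obtain ⟨γ, hγ, hγ'⟩ := hN.exists_eq_chartCovector c
  have := hh.codazzi α β γ hα hβ hγ p
  rw [covDeriv_chartCovector D hh.smooth_bivector hh.symm he hN hp hβ hγ hβ' hγ',
    covDeriv_chartCovector D hh.smooth_bivector hh.symm he hN hp hα hγ hα' hγ',
    hα' p hp, hβ' p hp, ← chartSharpAt_apply, ← chartSharpAt_apply] at this
  have h1 : chartSharp h e (e p) = chartSharpAt h e p := by
    rw [chartSharp, e.left_inv (hN.subset hp)]
  have h2 : christoffel D e (e p) = christoffelAt D e p := by
    rw [christoffel, e.left_inv (hN.subset hp)]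
  rw [h1, h2]
  exact this

end GPH

/-! ### Hessian charts on a manifold -/

section

open scoped RealInnerProductSpace

/-- The orthogonal projection onto the span of an orthonormal family. -/
noncomputable def orthonormalProj {E ι : Type*} [NormedAddCommGroup E] [InnerProductSpace ℝ E]
    [Fintype ι] (v : ι → E) : E →L[ℝ] E :=
  ∑ i, (innerSL ℝ (v i)).smulRight (v i)

variable {E ι : Type*} [NormedAddCommGroup E] [InnerProductSpace ℝ E] [Fintype ι] {v : ι → E}

theorem orthonormalProj_apply (w : E) : orthonormalProj v w = ∑ i, ⟪v i, w⟫ • v i := by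
  simp [orthonormalProj]

theorem orthonormalProj_symm (a b : E) : ⟪orthonormalProj v a, b⟫ = ⟪a, orthonormalProj v b⟫ := by
  simp only [orthonormalProj_apply, sum_inner, inner_sum, inner_smul_left, inner_smul_right]
  refine Finset.sum_congr rfl fun i _ ↦ ?_
  rw [real_inner_comm a, mul_comm]
  simp

theorem orthonormalProj_self (hv : Orthonormal ℝ v) (i : ι) : orthonormalProj v (v i) = v i := by
  classical
  simp [orthonormalProj_apply, orthonormal_iff_ite.1 hv]

theorem orthonormalProj_orthonormalProj (hv : Orthonormal ℝ v) (w : E) :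
    orthonormalProj v (orthonormalProj v w) = orthonormalProj v w := by
  rw [orthonormalProj_apply w, map_sum]
  simp [orthonormalProj_self hv]

theorem finrank_range_orthonormalProj (hv : Orthonormal ℝ v) :
    Module.finrank ℝ (LinearMap.range (orthonormalProj v).toLinearMap) = Fintype.card ι := by
  suffices h1 : LinearMap.range (orthonormalProj v).toLinearMap = Submodule.span ℝ (range v) by
    rw [h1, finrank_span_eq_card hv.linearIndependent]
  apply le_antisymm
  · rintro _ ⟨w, rfl⟩
    rw [ContinuousLinearMap.coe_coe, orthonormalProj_apply]
    exact Submodule.sum_mem _ fun i _ ↦ Submodule.smul_mem _ _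
      (Submodule.subset_span (mem_range_self i))
  · rw [Submodule.span_le]
    rintro _ ⟨i, rfl⟩
    exact ⟨v i, orthonormalProj_self hv i⟩

end

namespace GPH

open Bundle
open scoped RealInnerProductSpace

variable {n : ℕ} {M : Type*} [TopologicalSpace M] [ChartedSpace (Model n) M]

theorem IsExtensionDomain.mono {e : OpenPartialHomeomorph M (Model n)} [IsManifold (𝓡 n) ∞ M]
    {N N' : Set M} (hN : IsExtensionDomain e N) (hN' : IsOpen N') (h : N' ⊆ N) :
    IsExtensionDomain e N' where
  isOpen := hN'
  subset := h.trans hN.subset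
  exists_vField v := (hN.exists_vField v).imp fun _ hZ ↦ ⟨hZ.1, fun p hp ↦ hZ.2 p (h hp)⟩
  exists_oneForm a := (hN.exists_oneForm a).imp fun _ hη ↦ ⟨hη.1, fun p hp ↦ hη.2 p (h hp)⟩

theorem exists_centered_chart [IsManifold (𝓡 n) ∞ M] (x : M) :
    ∃ e ∈ IsManifold.maximalAtlas (𝓡 n) ∞ M, x ∈ e.source ∧ e x = (0 : Model n) := by
  refine ⟨(chartAt (Model n) x).trans
    (Homeomorph.addRight (-chartAt (Model n) x x)).toOpenPartialHomeomorph,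
    trans_mem_maximalAtlas (IsManifold.chart_mem_maximalAtlas x) ?_ ?_, ?_, ?_⟩
  · exact (contDiff_id.add contDiff_const).contDiffOn
  · exact (contDiff_id.add contDiff_const).contDiffOn
  · simp
  · simp

theorem rank_le [IsManifold (𝓡 n) ∞ M] (h : Bivector n M) (p : M) : rank h p ≤ n := by
  have h1 : Module.finrank ℝ (Tan n p) = n := finrank_euclideanSpace_fin (𝕜 := ℝ)
  exact (Submodule.finrank_le _).trans h1.le

end GPH

open GPH
open scoped RealInnerProductSpace

theorem theorem6p3 {n : ℕ} {M : Type*} [TopologicalSpace M] [T2Space M]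
    [ChartedSpace (EuclideanSpace ℝ (Fin n)) M] [IsManifold (𝓡 n) ∞ M]
    (D : GPH.Connection n M) (h : GPH.Bivector n M)
    (hh : GPH.IsGeneralizedPseudoHessian D h)
    (x : M) (r : ℕ) (hr : ∀ᶠ p in 𝓝 x, GPH.rank h p = r) :
    ∃ (hrn : r ≤ n) (φ : OpenPartialHomeomorph M (EuclideanSpace ℝ (Fin n)))
      (f : EuclideanSpace ℝ (Fin n) → ℝ) (a : M → Matrix (Fin r) (Fin r) ℝ),
      φ ∈ IsManifold.maximalAtlas (𝓡 n) ∞ M ∧ x ∈ φ.source ∧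
      ContDiffOn ℝ ∞ f φ.target ∧
      ∀ p ∈ φ.source,
        h p = ∑ i, ∑ j, a p i j • GPH.tensor (GPH.coordField φ (Fin.castLE hrn i) p)
          (GPH.coordField φ (Fin.castLE hrn j) p) ∧
        (∀ i j : Fin r, D (GPH.coordField φ (Fin.castLE hrn j)) p
          (GPH.coordField φ (Fin.castLE hrn i) p) = 0) ∧
        IsUnit (a p) ∧
        (a p)⁻¹ = Matrix.of fun i j : Fin r ↦
          GPH.partial₂ f (Fin.castLE hrn i) (Fin.castLE hrn j) (φ p) := by
  have hrn : r ≤ n := hr.self_of_nhds ▸ rank_le h x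
  obtain ⟨e, he, hxe, hx0⟩ := exists_centered_chart (n := n) x
  obtain ⟨N₀, hxN₀, hN₀⟩ := exists_isExtensionDomain he hxe
  obtain ⟨R, hR, hRo, hxR⟩ := eventually_nhds_iff.1 hr
  have hN : IsExtensionDomain e (N₀ ∩ R) := hN₀.mono (hN₀.isOpen.inter hRo) inter_subset_left
  set ε : Fin r → Model n := fun i ↦ EuclideanSpace.single (Fin.castLE hrn i) 1
  have hεo : Orthonormal ℝ ε :=
    (EuclideanSpace.orthonormal_single (𝕜 := ℝ)).comp _ (Fin.castLE_injective hrn)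
  have hπε := orthonormalProj_self hεo
  have hON : ∀ z ∈ e.target ∩ e.symm ⁻¹' (N₀ ∩ R), e.symm z ∈ e.source ∧ e.symm z ∈ R :=
    fun z hz ↦ ⟨e.map_target hz.1, hz.2.2⟩
  obtain ⟨ψ, f, X, T, Q, h0ψ, hψO, hψ, hψ', hf, hX, H⟩ := exists_hessian_chart
    (Γ := christoffel D e) (S := chartSharp h e) (O := e.target ∩ e.symm ⁻¹' (N₀ ∩ R))
    (π := orthonormalProj ε)
    (e.symm.isOpen_inter_preimage hN.isOpen)
    ⟨hx0 ▸ e.map_source hxe, by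
      rw [mem_preimage, ← hx0, e.left_inv hxe]; exact ⟨hxN₀, hxR⟩⟩
    (contDiffOn_christoffel hh.smooth_connection he hN)
    (fun z hz v w ↦ christoffelAt_symm hh.torsion_eq_zero he (hON z hz).1 v w)
    (fun z hz v w ↦ christoffel_flat hh.smooth_connection hh.flat he hN hz v w)
    (orthonormalProj_orthonormalProj hεo) orthonormalProj_symm
    (contDiffOn_chartSharp hh.smooth_bivector he hN)
    (fun z _ a b ↦ by
      rw [real_inner_comm, chartSharp, inner_chartSharpAt, inner_chartSharpAt, hh.symm])
    (fun z hz ↦ by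
      rw [chartSharp, finrank_range_chartSharpAt he (hON z hz).1, hR _ (hON z hz).2,
        finrank_range_orthonormalProj hεo, Fintype.card_fin])
    (fun z hz a b c ↦ chartSharp_codazzi hh he hN hz a b c)
  have hφ := trans_mem_maximalAtlas he hψ hψ'
  -- both sides are mapped to the `i`-th basis vector by the derivative of `e.trans ψ`
  have hcoord : ∀ q ∈ (e.trans ψ).source, ∀ i : Fin r,
      coordField (e.trans ψ) (Fin.castLE hrn i) q = chartField e (fun z ↦ X z (ε i)) q := by
    intro q hq i
    rw [← inverse_chartDeriv hφ hq (chartField e (fun z ↦ X z (ε i)) q),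
      chartDeriv_trans he hψ hq.1 hq.2, chartDeriv_chartField he hq.1, (H (e q) hq.2).2.2.2.2.1, hπε]
    rfl
  refine ⟨hrn, e.trans ψ, f, fun p ↦ Matrix.of fun i j ↦ ⟪ε j, T (e p) (ε i)⟫, hφ,
    ⟨hxe, by simpa [hx0] using h0ψ⟩, hf.contDiffOn, fun p hp ↦ ?_⟩
  obtain ⟨hTQ, hXπ, hS, hpar, -, hhess⟩ := H (e p) hp.2
  refine ⟨?_, fun i j ↦ ?_, ?_⟩
  -- the bivector
  · have hadj : ∀ a, adjointCLM _ (X (e p)) a = ∑ i, ⟪a, X (e p) (ε i)⟫ • ε i := by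
      intro a
      refine ext_inner_right ℝ fun w ↦ ?_
      rw [inner_adjointCLM, ← hXπ, orthonormalProj_apply, map_sum, inner_sum, sum_inner]
      refine Finset.sum_congr rfl fun i _ ↦ ?_
      rw [map_smul, inner_smul_left, inner_smul_right, mul_comm]
      simp
    ext α β
    obtain ⟨a, rfl⟩ := (chartCovector_bijective he hp.1).2 α
    obtain ⟨b, rfl⟩ := (chartCovector_bijective he hp.1).2 β
    have hS' : chartSharpAt h e p = chartSharp h e (e p) := by
      rw [chartSharp, e.left_inv hp.1]
    rw [← inner_chartSharpAt, hS', hS]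
    simp only [mul_apply_eq_comp]
    rw [← inner_adjointCLM, hadj a, hadj b]
    simp only [hcoord p hp, _root_.sum_apply, _root_.smul_apply, tensor_apply, chartCovector_apply,
      chartDeriv_chartField he hp.1, map_sum, map_smul, sum_inner, inner_sum, inner_smul_left,
      inner_smul_right, Matrix.of_apply, smul_eq_mul]
    refine Finset.sum_congr rfl fun i _ ↦ ?_
    rw [Finset.mul_sum]
    refine Finset.sum_congr rfl fun j _ ↦ ?_
    simp
    ring
  -- the coordinate fields are parallel along the leaves
  · have hXd : DifferentiableAt ℝ X (e p) :=
      (hX.contDiffAt (ψ.open_source.mem_nhds hp.2)).differentiableAt (by simp)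
    have h1 : HasFDerivAt (fun z ↦ X z (ε j)) _ (e p) :=
      hXd.hasFDerivAt.clm_apply (hasFDerivAt_const (ε j) _)
    have h2 := chartDeriv_connection_of_eventuallyEq D he hp.1 h1.differentiableAt
      (Filter.eventually_of_mem ((e.trans ψ).open_source.mem_nhds hp) fun q hq ↦ hcoord q hq j)
      (coordField (e.trans ψ) (Fin.castLE hrn i) p)
    have h3 := hpar (ε i) (ε j)
    rw [christoffel, e.left_inv hp.1] at h3
    rw [hcoord p hp, chartDeriv_chartField he hp.1, h1.fderiv] at h2
    rw [← inverse_chartDeriv he hp.1 (D _ p _), hcoord p hp, h2]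
    simp [h3]
  -- the Hessian is a left inverse of `a p`
  · have h1 : (Matrix.of fun i j : Fin r ↦
        partial₂ f (Fin.castLE hrn i) (Fin.castLE hrn j) ((e.trans ψ) p)) *
        (Matrix.of fun i j ↦ ⟪ε j, T (e p) (ε i)⟫) = 1 := by
      ext i k
      have h2 : ∀ j, partial₂ f (Fin.castLE hrn i) (Fin.castLE hrn j) ((e.trans ψ) p) =
          ⟪ε j, Q (e p) (ε i)⟫ := fun j ↦ by
        have := hhess (ε i) (ε j)
        rw [hπε, hπε, real_inner_comm] at this
        exact this
      simp only [Matrix.mul_apply, Matrix.of_apply, h2]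
      have h3 : ⟪ε k, T (e p) (orthonormalProj ε (Q (e p) (ε i)))⟫ =
          ∑ j, ⟪ε j, Q (e p) (ε i)⟫ * ⟪ε k, T (e p) (ε j)⟫ := by
        rw [orthonormalProj_apply, map_sum, inner_sum]
        simp [inner_smul_right]
      rw [← h3, hTQ.left, ← hπε k, orthonormalProj_symm, hTQ.comp, hπε, orthonormal_iff_ite.1 hεo,
        Matrix.one_apply]
      simp [eq_comm]
    exact ⟨⟨⟨_, _, mul_eq_one_comm.1 h1, h1⟩, rfl⟩, Matrix.inv_eq_left_inv h1⟩
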